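/- Let $r\ge 1$, $\nu\ge r$ and $m\ge 0$ be integers with $m\le \nu+1-r$, and let $\sigma>0$, $A>0$. For an integer $k\ge 0$ let $W^{k,p}$ be the Sobolev space of functions on $[0,\infty)$ which, together with their weak derivatives of orders $1,\dots,k$, lie in $L_p([0,\infty))$; write $W^k=W^{k,2}$ and $W^m(A)=\{f\in W^m:\ \sum_{j=0}^m\|f^{(j)}\|_{L_2([0,\infty))}^2\le A^2\}$. Let $g\in W^{r,1}\cap W^{\nu}$ be a known kernel such that $g^{(j)}(0)=0$ for $j=0,\dots,r-2$ and $g^{(r-1)}(0)=B_r\ne 0$ (values at $0$ of the continuous versions), and such that all zeros of its Laplace transform $\tilde g(s)=\int_0^\infty e^{-sx}g(x)\,dx$ have negative real parts. Let $T_n\to\infty$ with $T_n^2/n\to 0$, and for each $n$ let $0\le t_1\le\dots\le t_n\le T_n$ be design points (depending on $n$) such that, for some $1\le\mu<\infty$ independent of $n$, $\max_{2\le i\le n}|t_i-t_{i-1}|\le \mu T_n/n$. One observes $$y_i=\int_0^{t_i}g(t_i-\tau)f(\tau)\,d\tau+\sigma\varepsilon_i,\qquad i=1,\dots,n,$$ with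 $\varepsilon_i$ i.i.d. $N(0,1)$. Then there exists a constant $C>0$, independent of $n$, such that for all $n\ge 1$ with $T_n>0$ $$\inf_{\hat f_n}\ \sup_{f\in W^m(A)} E\|\hat f_n-f\|^2_{L_2([0,T_n])}\ \ge\ C\left(\frac{T_n^2}{n}\right)^{\frac{2m}{2(m+r)+1}},$$ where the infimum is over all estimators $\hat f_n$ based on $y_1,\dots,y_n$, and, with the same $C$, $$\inf_{\hat f_n}\ \sup_{f\in W^m(A)} E\|\hat f_n-f\|^2_{L_2([0,\infty))}\ \ge\ C\left(\frac{T_n^2}{n}\right)^{\frac{2m}{2(m+r)+1}}.$$ -/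

import Mathlib

open MeasureTheory ProbabilityTheory Set Filter Topology
open scoped ENNReal NNReal ContDiff

namespace LaplaceDeconv

/-- Lebesgue measure on the half-line `(0, ∞)`. -/
noncomputable def halfLine : Measure ℝ := volume.restrict (Ioi 0)

/-- `h` is a `j`-th weak derivative of `f` on `(0, ∞)`. Only the values of `f` and `h` on `(0, ∞)`
matter. -/
def HasWeakDeriv (j : ℕ) (f h : ℝ → ℝ) : Prop :=
  LocallyIntegrableOn f (Ioi 0) volume ∧ LocallyIntegrableOn h (Ioi 0) volume ∧
    ∀ φ : ℝ → ℝ, ContDiff ℝ ∞ φ → HasCompactSupport φ → tsupport φ ⊆ Ioi 0 →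
      ∫ x in Ioi 0, f x * iteratedDeriv j φ x = (-1) ^ j * ∫ x in Ioi 0, h x * φ x

/-- The Sobolev space `W^{k,p}(ℝ⁺)`: `f` and its weak derivatives of orders `1, …, k` exist and
have finite `L_p` norm on the half-line. -/
def MemSobolev (k : ℕ) (p : ℝ≥0∞) (f : ℝ → ℝ) : Prop :=
  MemLp f p halfLine ∧ ∀ j ≤ k, ∃ h : ℝ → ℝ, HasWeakDeriv j f h ∧ MemLp h p halfLine

/-- The ball `W^m(A)` of radius `A` in `W^m(ℝ⁺) = W^{m,2}(ℝ⁺)`, for the norm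
`‖f‖² = ∑_{j=0}^m ‖f^{(j)}‖²` (weak derivatives are unique up to null sets). -/
def sobolevBall (m : ℕ) (A : ℝ) : Set (ℝ → ℝ) :=
  {f | MemSobolev m 2 f ∧ ∃ h : ℕ → ℝ → ℝ, (∀ j ≤ m, HasWeakDeriv j f (h j)) ∧
    ∑ j ∈ Finset.range (m + 1), eLpNorm (h j) 2 halfLine ^ 2 ≤ ENNReal.ofReal (A ^ 2)}

/-- `g^{(j)}(0) = b`: the `j`-th weak derivative of `g` has a version that is continuous on
`[0, ∞)` and takes the value `b` at `0`. -/
def DerivAtZeroEq (j : ℕ) (g : ℝ → ℝ) (b : ℝ) : Prop :=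
  ∃ h : ℝ → ℝ, HasWeakDeriv j g h ∧ ContinuousOn h (Ici 0) ∧ h 0 = b

/-- `g^{(j)}(0) = 0` for `j = 0, …, r - 2` and `g^{(r-1)}(0) = B_r ≠ 0`. -/
def KernelCond (r : ℕ) (g : ℝ → ℝ) : Prop :=
  (∀ j : ℕ, j + 1 < r → DerivAtZeroEq j g 0) ∧ ∃ B : ℝ, B ≠ 0 ∧ DerivAtZeroEq (r - 1) g B

/-- The Laplace transform `∫_0^∞ e^{-sx} g(x) dx`. -/
noncomputable def laplaceTransform (g : ℝ → ℝ) (s : ℂ) : ℂ :=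
  ∫ x in Ioi (0 : ℝ), Complex.exp (-s * x) * (g x : ℂ)

/-- All zeros of the Laplace transform of `g`, at points where it is defined, have negative real
part. -/
def LaplaceZerosNegRe (g : ℝ → ℝ) : Prop :=
  ∀ s : ℂ, IntegrableOn (fun x : ℝ => Complex.exp (-s * x) * (g x : ℂ)) (Ioi 0) volume →
    laplaceTransform g s = 0 → s.re < 0

/-- `q(u) = ∫_0^u g(u - τ) f(τ) dτ`. -/
noncomputable def laplaceConv (g f : ℝ → ℝ) (u : ℝ) : ℝ :=
  ∫ τ in (0 : ℝ)..u, g (u - τ) * f τ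

/-- The interval lengths `T n` and the design points `t n 0 ≤ … ≤ t n (n - 1)` in `[0, T n]`. -/
structure DesignCond (T : ℕ → ℝ) (t : (n : ℕ) → Fin n → ℝ) : Prop where
  monotone : ∀ n, Monotone (t n)
  mem_Icc : ∀ n i, t n i ∈ Icc 0 (T n)
  tendsto_atTop : Tendsto T atTop atTop
  tendsto_zero : Tendsto (fun n : ℕ => T n ^ 2 / (n : ℝ)) atTop (𝓝 0)
  spacing : ∃ μ : ℝ, 1 ≤ μ ∧ ∀ (n : ℕ) (i j : Fin n), (j : ℕ) = (i : ℕ) + 1 →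
    |t n j - t n i| ≤ μ * T n / (n : ℝ)

/-- The law of the data `y_i = (g ∗ f)(t_i) + σ ε_i`, `i = 1, …, n`, with `ε_i` i.i.d. `N(0,1)`. -/
noncomputable def dataLaw {n : ℕ} (g : ℝ → ℝ) (σ : ℝ) (t : Fin n → ℝ) (f : ℝ → ℝ) :
    Measure (Fin n → ℝ) :=
  (Measure.pi fun _ : Fin n => gaussianReal 0 1).map
    fun ε i => laplaceConv g f (t i) + σ * ε i

/-- Estimators of a function from `n` data: jointly measurable in the data and the argument. -/
abbrev Estimator (n : ℕ) : Type :=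
  {F : (Fin n → ℝ) → ℝ → ℝ // Measurable (Function.uncurry F)}

/-- The risk `E ‖F(y) - f‖²_{L_2(I)}`, a value in `[0, ∞]`. -/
noncomputable def risk {n : ℕ} (g : ℝ → ℝ) (σ : ℝ) (t : Fin n → ℝ) (I : Set ℝ)
    (F : Estimator n) (f : ℝ → ℝ) : ℝ≥0∞ :=
  ∫⁻ y, eLpNorm (fun x => F.1 y x - f x) 2 (volume.restrict I) ^ 2 ∂(dataLaw g σ t f)

/-- The minimax risk over `W^m(A)`. -/
noncomputable def minimaxRisk {n : ℕ} (g : ℝ → ℝ) (σ : ℝ) (t : Fin n → ℝ) (I : Set ℝ)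
    (m : ℕ) (A : ℝ) : ℝ≥0∞ :=
  ⨅ F : Estimator n, ⨆ f ∈ sobolevBall m A, risk g σ t I F f

end LaplaceDeconv

/-! The bound is Assouad's lemma on a hypercube of disjoint bumps that the convolution nearly hides.
Fix a smooth `ψ` supported inside `(0, 1)` and put `θ = ψ^{(r)}`. Scale `θ` to width `h` and place
one copy on each of `M` adjacent cells, with amplitude `c`. The kernel vanishes to order `r - 1` at
`0`, so `r` integrations by parts turn `g ∗ θ_k` into `h^r (B ψ_k + H ∗ ψ_k)`, where `H = g^{(r)}`
is in `L_2` (`KernelCond.exists_laplaceConv_iteratedDeriv`). This gains a factor `h^r`.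

The tail `H ∗ ψ_k` spreads beyond its cell, but Bessel's inequality bounds the sum over `k` of the
squared images at any single point by `K h^{2r}` (`KernelCond.exists_sum_laplaceConv_tile_sq_le`),
whatever the number of tiles. Summed over the design, the total energy is at most `n c² h^{2r} K`.
If this is small compared with `M σ²`, at least half of the tiles are individually undetectable,
wherever the design points lie. Assouad's argument on those tiles (`le_of_risk_tileSum_le`) gives
risk of order `M c² h`.

With `M ≈ T/h`, membership in the ball allows `c² ≈ h^{2m}/T`, and undetectability then requires
`h^{2(m+r)+1} ≲ T²/n`. The resulting bound has order `h^{2m}`, which is the stated rate. Finitely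
many `n` are absorbed into the constant by using a single tile. -/

namespace LaplaceDeconv

/-! ### Gaussian shifts and two-point testing -/

/-- The likelihood ratio of `N(a, I)` with respect to `N(0, I)`. -/
noncomputable def shiftDensity {n : ℕ} (a ε : Fin n → ℝ) : ℝ :=
  Real.exp (∑ i, (a i * ε i - a i ^ 2 / 2))

lemma measurable_shiftDensity {n : ℕ} (a : Fin n → ℝ) : Measurable (shiftDensity a) := by
  unfold shiftDensity; fun_prop

lemma gaussianReal_map_add_eq_withDensity (a : ℝ) :
    (gaussianReal 0 1).map (· + a) =
      (gaussianReal 0 1).withDensity fun x => ENNReal.ofReal (Real.exp (a * x - a ^ 2 / 2)) := by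
  rw [gaussianReal_map_add_const, gaussianReal_of_var_ne_zero _ one_ne_zero,
    gaussianReal_of_var_ne_zero _ one_ne_zero, ← withDensity_mul _ (by fun_prop) (by fun_prop)]
  congr 1
  ext x
  simp only [gaussianPDF, gaussianPDFReal, Pi.mul_apply, NNReal.coe_one, mul_one, zero_add,
    sub_zero]
  rw [← ENNReal.ofReal_mul (by positivity), mul_assoc, ← Real.exp_add]
  congr 3
  ring

/-- On boxes both sides factor over the coordinates, because the exponential of a sum is a product
and the coordinates are independent. Boxes determine the product measure. -/
lemma pi_gaussian_map_add_eq_withDensity {n : ℕ} (a : Fin n → ℝ) :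
    (Measure.pi fun _ : Fin n => gaussianReal 0 1).map (fun ε i => ε i + a i) =
      (Measure.pi fun _ : Fin n => gaussianReal 0 1).withDensity
        fun ε => ENNReal.ofReal (shiftDensity a ε) := by
  have (i : Fin n) : IsProbabilityMeasure ((gaussianReal 0 1).map (· + a i)) :=
    Measure.isProbabilityMeasure_map (by fun_prop)
  rw [Measure.pi_map_pi (f := fun i x => x + a i) (fun i => by fun_prop)]
  refine Measure.pi_eq fun s hs => ?_
  rw [withDensity_apply _ (MeasurableSet.univ_pi hs),
    ← lintegral_indicator (MeasurableSet.univ_pi hs)]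
  have key : ∀ ε : Fin n → ℝ,
      (univ.pi s).indicator (fun ε => ENNReal.ofReal (shiftDensity a ε)) ε =
      ∏ i, (s i).indicator (fun x => ENNReal.ofReal (Real.exp (a i * x - a i ^ 2 / 2))) (ε i) := by
    intro ε
    by_cases h : ε ∈ univ.pi s
    · rw [indicator_of_mem h, shiftDensity, Real.exp_sum,
        ENNReal.ofReal_prod_of_nonneg fun i _ => (Real.exp_pos _).le]
      exact Finset.prod_congr rfl fun i _ => (indicator_of_mem (h i (mem_univ i))
        fun x => ENNReal.ofReal (Real.exp (a i * x - a i ^ 2 / 2))).symm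
    · rw [indicator_of_notMem h]
      simp only [mem_univ_pi, not_forall] at h
      obtain ⟨i, hi⟩ := h
      exact (Finset.prod_eq_zero (Finset.mem_univ i) (indicator_of_notMem hi _)).symm
  simp_rw [key]
  have hmeas : ∀ i, Measurable ((s i).indicator
      fun x => ENNReal.ofReal (Real.exp (a i * x - a i ^ 2 / 2))) := fun i =>
    Measurable.indicator (by fun_prop) (hs i)
  rw [lintegral_prod_eq_prod_lintegral_of_indepFun Finset.univ
    (fun i (ε : Fin n → ℝ) => (s i).indicator
      (fun x => ENNReal.ofReal (Real.exp (a i * x - a i ^ 2 / 2))) (ε i))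
    (iIndepFun_pi (X := fun i => (s i).indicator
      fun x => ENNReal.ofReal (Real.exp (a i * x - a i ^ 2 / 2))) fun i => (hmeas i).aemeasurable)
    (fun i => (hmeas i).comp (measurable_pi_apply i))]
  refine Finset.prod_congr rfl fun i _ => ?_
  rw [gaussianReal_map_add_eq_withDensity, withDensity_apply _ (hs i),
    ← lintegral_indicator (hs i)]
  exact (measurePreserving_eval (fun _ : Fin n => gaussianReal 0 1) i).lintegral_comp (hmeas i)

lemma lintegral_shiftDensity {n : ℕ} (a : Fin n → ℝ) :
    ∫⁻ ε, ENNReal.ofReal (shiftDensity a ε) ∂(Measure.pi fun _ : Fin n => gaussianReal 0 1) = 1 := by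
  have hp : IsProbabilityMeasure ((Measure.pi fun _ : Fin n => gaussianReal 0 1).map
      (fun ε i => ε i + a i)) :=
    Measure.isProbabilityMeasure_map (by fun_prop : Measurable _).aemeasurable
  have := hp.measure_univ
  rwa [pi_gaussian_map_add_eq_withDensity, withDensity_apply _ MeasurableSet.univ,
    Measure.restrict_univ] at this

/-- Since a shift density integrates to one, this gives the second moment `exp (∑ a_i²)` of the
likelihood ratio. -/
lemma shiftDensity_sq {n : ℕ} (a ε : Fin n → ℝ) :
    shiftDensity a ε ^ 2 = Real.exp (∑ i, a i ^ 2) * shiftDensity (fun i => 2 * a i) ε := by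
  rw [shiftDensity, shiftDensity, ← Real.exp_nat_mul, ← Real.exp_add, ← Finset.sum_add_distrib,
    Finset.mul_sum]
  congr 1
  refine Finset.sum_congr rfl fun i _ => ?_
  push_cast; ring

/-- Two-point lower bound for the testing problem `N(0, I)` against `N(a, I)`. -/
lemma two_point_gaussian {n : ℕ} (a : Fin n → ℝ) (ha : ∑ i, a i ^ 2 ≤ Real.log (5 / 4))
    {L L' : (Fin n → ℝ) → ℝ≥0∞} (hL : Measurable L) (hL' : Measurable L') {D : ℝ} (hD : 0 ≤ D)
    (h : ∀ ε, ENNReal.ofReal D ≤ L ε + L' ε) :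
    ENNReal.ofReal (D / 2) ≤ ∫⁻ ε, L ε ∂(Measure.pi fun _ : Fin n => gaussianReal 0 1) +
      ∫⁻ ε, L' ε ∂((Measure.pi fun _ : Fin n => gaussianReal 0 1).map fun ε i => ε i + a i) := by
  set P := Measure.pi fun _ : Fin n => gaussianReal 0 1
  have hΛ := measurable_shiftDensity a
  rw [pi_gaussian_map_add_eq_withDensity, lintegral_withDensity_eq_lintegral_mul _
    (by fun_prop) hL', ← lintegral_add_left hL]
  set X := ∫⁻ ε, L ε + ((fun ε => ENNReal.ofReal (shiftDensity a ε)) * L') ε ∂P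
  -- The target is `E min(1, Λ) ≥ 2 - 1/4 - 5/4 = 1/2`. The inequality is kept additive, since
  -- truncated subtraction in `ℝ≥0∞` would lose information.
  have hpt : ∀ ε, ENNReal.ofReal (2 * D) * ENNReal.ofReal (shiftDensity a ε) ≤
      (L ε + ((fun ε => ENNReal.ofReal (shiftDensity a ε)) * L') ε) + (ENNReal.ofReal (D / 4) +
      ENNReal.ofReal (D * Real.exp (∑ i, a i ^ 2)) *
        ENNReal.ofReal (shiftDensity (fun i => 2 * a i) ε)) := by
    intro ε
    have hpos : 0 < shiftDensity a ε := Real.exp_pos _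
    have hmin : ENNReal.ofReal (min 1 (shiftDensity a ε) * D) ≤
        L ε + ENNReal.ofReal (shiftDensity a ε) * L' ε := by
      rw [ENNReal.ofReal_mul (by positivity)]
      calc _ ≤ ENNReal.ofReal (min 1 (shiftDensity a ε)) * (L ε + L' ε) := by gcongr; exact h ε
        _ ≤ ENNReal.ofReal 1 * L ε + ENNReal.ofReal (shiftDensity a ε) * L' ε := by
          rw [mul_add]; gcongr
          · exact min_le_left _ _
          · exact min_le_right _ _
        _ = _ := by simp
    refine le_trans ?_ (add_le_add_left hmin _)
    rw [← ENNReal.ofReal_mul (by positivity), ← ENNReal.ofReal_mul (by positivity), mul_assoc D,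
      ← shiftDensity_sq, ← ENNReal.ofReal_add (by positivity) (by positivity),
      ← ENNReal.ofReal_add (by positivity) (by positivity)]
    refine ENNReal.ofReal_le_ofReal ?_
    -- For `Λ ≤ 1` this is `(Λ - 1/2)² ≥ 0`; for `Λ > 1` it follows from `(Λ - 1)² ≥ 0`.
    have : 2 * shiftDensity a ε ≤ min 1 (shiftDensity a ε) + (1 / 4 + shiftDensity a ε ^ 2) := by
      rcases min_cases 1 (shiftDensity a ε) with ⟨h, _⟩ | ⟨h, _⟩ <;> rw [h] <;>
        nlinarith [sq_nonneg (shiftDensity a ε - 1 / 2), sq_nonneg (shiftDensity a ε - 1)]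
    nlinarith [mul_le_mul_of_nonneg_left this hD]
  have hint := lintegral_mono (μ := P) hpt
  have hm2 := measurable_shiftDensity fun i => 2 * a i
  have hm3 : Measurable fun ε => ENNReal.ofReal (D / 4) +
      ENNReal.ofReal (D * Real.exp (∑ i, a i ^ 2)) *
        ENNReal.ofReal (shiftDensity (fun i => 2 * a i) ε) := by fun_prop
  rw [lintegral_const_mul _ (by fun_prop), lintegral_shiftDensity, mul_one,
    lintegral_add_right _ hm3, lintegral_add_left measurable_const, lintegral_const,
    measure_univ, mul_one, lintegral_const_mul _ (by fun_prop), lintegral_shiftDensity,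
    mul_one] at hint
  have he : Real.exp (∑ i, a i ^ 2) ≤ 5 / 4 := by
    rw [← Real.exp_log (show (0 : ℝ) < 5 / 4 by norm_num)]; exact Real.exp_le_exp.2 ha
  have h3 : ENNReal.ofReal (D / 2) + ENNReal.ofReal (3 / 2 * D) ≤
      X + ENNReal.ofReal (3 / 2 * D) := by
    rw [← ENNReal.ofReal_add (by positivity) (by positivity)]
    calc _ = ENNReal.ofReal (2 * D) := by congr 1; ring
      _ ≤ _ := hint
      _ ≤ _ := by
        gcongr
        rw [← ENNReal.ofReal_add (by positivity) (by positivity)]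
        exact ENNReal.ofReal_le_ofReal (by nlinarith)
  exact (ENNReal.add_le_add_iff_right ENNReal.ofReal_ne_top).1 h3

/-- Two-point lower bound for data laws with different regression functions. -/
lemma two_point_dataLaw {n : ℕ} (g : ℝ → ℝ) {σ : ℝ} (hσ : 0 < σ) (t : Fin n → ℝ)
    (f₀ f₁ : ℝ → ℝ)
    (hclose : ∑ i, (laplaceConv g f₁ (t i) - laplaceConv g f₀ (t i)) ^ 2 ≤
      σ ^ 2 * Real.log (5 / 4))
    {L L' : (Fin n → ℝ) → ℝ≥0∞} (hL : Measurable L) (hL' : Measurable L') {D : ℝ} (hD : 0 ≤ D)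
    (h : ∀ y, ENNReal.ofReal D ≤ L y + L' y) :
    ENNReal.ofReal (D / 2) ≤ ∫⁻ y, L y ∂(dataLaw g σ t f₀) + ∫⁻ y, L' y ∂(dataLaw g σ t f₁) := by
  let a : Fin n → ℝ := fun i => (laplaceConv g f₁ (t i) - laplaceConv g f₀ (t i)) / σ
  let Φ : (Fin n → ℝ) → Fin n → ℝ := fun ε i => laplaceConv g f₀ (t i) + σ * ε i
  have hΦ : Measurable Φ := by fun_prop
  -- Both laws are images under the same affine map `Φ`, of the standard noise and of the shifted
  -- noise.
  have e₁ : dataLaw g σ t f₁ =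
      ((Measure.pi fun _ : Fin n => gaussianReal 0 1).map fun ε i => ε i + a i).map Φ := by
    rw [Measure.map_map hΦ (by fun_prop), dataLaw]
    congr 1
    ext ε i
    simp only [Function.comp_apply, Φ, a]
    field_simp
    ring
  rw [e₁, dataLaw, lintegral_map hL hΦ, lintegral_map hL' hΦ]
  refine two_point_gaussian a ?_ (hL.comp hΦ) (hL'.comp hΦ) hD fun ε => h _
  simp only [a, div_pow, ← Finset.sum_div]
  rwa [div_le_iff₀ (by positivity), mul_comm]

/-! ### Cutoffs near the origin and integration by parts up to the boundary -/

lemma tsupport_iteratedDeriv_subset (f : ℝ → ℝ) (j : ℕ) :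
    tsupport (iteratedDeriv j f) ⊆ tsupport f := by
  induction j with
  | zero => simp
  | succ j ih => rw [iteratedDeriv_succ]; exact Subset.trans tsupport_deriv_subset ih

lemma hasCompactSupport_iteratedDeriv {f : ℝ → ℝ} (hf : HasCompactSupport f) (j : ℕ) :
    HasCompactSupport (iteratedDeriv j f) :=
  hf.of_isClosed_subset (isClosed_tsupport _) (tsupport_iteratedDeriv_subset f j)

lemma contDiff_infty_iteratedDeriv {f : ℝ → ℝ} (hf : ContDiff ℝ ∞ f) (j : ℕ) :
    ContDiff ℝ ∞ (iteratedDeriv j f) := by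
  induction j with
  | zero => simpa
  | succ j ih => rw [iteratedDeriv_succ]; exact (contDiff_infty_iff_deriv.1 ih).2

lemma exists_forall_lt_eq_zero {φ : ℝ → ℝ} (hφ : HasCompactSupport φ) :
    ∃ R : ℝ, 0 < R ∧ ∀ x, R < x → φ x = 0 := by
  obtain ⟨R, hR⟩ := hφ.isCompact.isBounded.subset_closedBall 0
  refine ⟨max R 1, by positivity, fun x hx => ?_⟩
  by_contra h
  have := hR (subset_tsupport φ h)
  rw [mem_closedBall_zero_iff] at this
  have := (le_abs_self x).trans this
  exact absurd (le_max_left R 1) (by linarith)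

lemma integrableOn_Ioi_mul {b φ : ℝ → ℝ} (hb : ∀ R, IntegrableOn b (Ioc 0 R))
    (hφc : Continuous φ) (hφ : HasCompactSupport φ) :
    IntegrableOn (fun x => b x * φ x) (Ioi 0) := by
  obtain ⟨R, hR, hR0⟩ := exists_forall_lt_eq_zero hφ
  obtain ⟨C, hC⟩ := hφc.bounded_above_of_compact_support hφ
  have h1 : IntegrableOn (fun x => b x * φ x) (Ioc 0 R) :=
    (hb R).mul_bdd hφc.aestronglyMeasurable (Eventually.of_forall hC)
  refine h1.of_forall_sdiff_eq_zero measurableSet_Ioi fun x hx => ?_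
  have : R < x := by
    by_contra h
    exact hx.2 ⟨hx.1, not_lt.1 h⟩
  rw [hR0 x this, mul_zero]

lemma _root_.ContinuousOn.integrableOn_Ioc_zero {a : ℝ → ℝ} (ha : ContinuousOn a (Ici 0)) (R : ℝ) :
    IntegrableOn a (Ioc 0 R) :=
  ((ha.mono Icc_subset_Ici_self).integrableOn_Icc).mono_set Ioc_subset_Icc_self

lemma exists_bound_mul {a φ : ℝ → ℝ} (ha : ContinuousOn a (Ici 0)) (hφc : Continuous φ)
    (hφ : HasCompactSupport φ) : ∃ C, ∀ x, 0 ≤ x → ‖a x * φ x‖ ≤ C := by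
  obtain ⟨R, hR, hR0⟩ := exists_forall_lt_eq_zero hφ
  obtain ⟨C, hC⟩ := isCompact_Icc.exists_bound_of_continuousOn
    ((ha.mono (Icc_subset_Ici_self : Icc 0 R ⊆ Ici 0)).mul hφc.continuousOn)
  refine ⟨C, fun x hx => ?_⟩
  by_cases h : x ≤ R
  · exact hC x ⟨hx, h⟩
  · rw [hR0 x (not_le.1 h), mul_zero, norm_zero]
    exact (norm_nonneg _).trans (hC 0 ⟨le_rfl, hR.le⟩)

/-- Smooth cutoff vanishing on `(-∞, 1/(n+1)]` and equal to `1` on `[2/(n+1), ∞)`. -/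
noncomputable def cutoff (n : ℕ) (x : ℝ) : ℝ := Real.smoothTransition ((n + 1) * x - 1)

lemma contDiff_cutoff (n : ℕ) : ContDiff ℝ ∞ (cutoff n) :=
  Real.smoothTransition.contDiff.comp (by fun_prop)

lemma norm_cutoff_le_one (n : ℕ) (x : ℝ) : ‖cutoff n x‖ ≤ 1 := by
  rw [cutoff, Real.norm_of_nonneg (Real.smoothTransition.nonneg _)]
  exact Real.smoothTransition.le_one _

lemma tendsto_cutoff {x : ℝ} (hx : 0 < x) : Tendsto (fun n => cutoff n x) atTop (𝓝 1) := by
  refine tendsto_const_nhds.congr' ?_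
  filter_upwards [eventually_ge_atTop ⌈2 / x⌉₊] with n hn
  refine (Real.smoothTransition.one_of_one_le ?_).symm
  have : 2 / x ≤ n := Nat.ceil_le.1 hn
  rw [div_le_iff₀ hx] at this
  nlinarith

lemma tsupport_mul_cutoff_subset (φ : ℝ → ℝ) (n : ℕ) :
    tsupport (fun x => φ x * cutoff n x) ⊆ Ioi 0 := by
  have h : tsupport (fun x => φ x * cutoff n x) ⊆ Ici (1 / (n + 1 : ℝ)) := by
    refine closure_minimal (fun x hx => ?_) isClosed_Ici
    by_contra h
    refine hx (mul_eq_zero_of_right _ (Real.smoothTransition.zero_of_nonpos ?_))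
    rw [mem_Ici, not_le, lt_div_iff₀ (by positivity)] at h
    linarith
  exact h.trans fun x hx => lt_of_lt_of_le (by positivity) (mem_Ici.1 hx)

lemma hasDerivAt_cutoff (n : ℕ) (x : ℝ) :
    HasDerivAt (cutoff n) ((n + 1) * deriv Real.smoothTransition ((n + 1) * x - 1)) x := by
  have h1 : HasDerivAt Real.smoothTransition (deriv Real.smoothTransition ((n + 1) * x - 1))
      ((n + 1) * x - 1) :=
    ((Real.smoothTransition.contDiff (n := 1)).differentiable (by simp) _).hasDerivAt
  have h2 : HasDerivAt (fun x : ℝ => (n + 1) * x - 1) (n + 1 : ℝ) x := by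
    simpa using ((hasDerivAt_id x).const_mul (n + 1 : ℝ)).sub_const 1
  rw [mul_comm]
  exact h1.comp x h2

lemma continuous_deriv_smoothTransition : Continuous (deriv Real.smoothTransition) :=
  (Real.smoothTransition.contDiff (n := 1)).continuous_deriv (by simp)

lemma deriv_smoothTransition_nonneg (x : ℝ) : 0 ≤ deriv Real.smoothTransition x :=
  Real.smoothTransition.monotone.deriv_nonneg

lemma integrableOn_deriv_smoothTransition_and_integral_eq_one :
    IntegrableOn (fun y => deriv Real.smoothTransition (y - 1)) (Ioi 0) ∧
      ∫ y in Ioi (0 : ℝ), deriv Real.smoothTransition (y - 1) = 1 := by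
  have hd : ∀ y : ℝ, HasDerivAt (fun y => Real.smoothTransition (y - 1))
      (deriv Real.smoothTransition (y - 1)) y := fun y =>
    HasDerivAt.comp_sub_const y 1
      ((Real.smoothTransition.contDiff (n := 1)).differentiable (by simp) _).hasDerivAt
  have ht : Tendsto (fun y => Real.smoothTransition (y - 1)) atTop (𝓝 1) := by
    refine tendsto_const_nhds.congr' ?_
    filter_upwards [eventually_ge_atTop 2] with y hy
    exact (Real.smoothTransition.one_of_one_le (by linarith)).symm
  have hc : ContinuousWithinAt (fun y => Real.smoothTransition (y - 1)) (Ici 0) 0 :=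
    (hd 0).continuousAt.continuousWithinAt
  have hi := integrableOn_Ioi_deriv_of_nonneg hc (fun y _ => hd y)
    (fun y _ => deriv_smoothTransition_nonneg _) ht
  refine ⟨hi, ?_⟩
  rw [integral_Ioi_of_hasDerivAt_of_tendsto hc (fun y _ => hd y) hi ht,
    Real.smoothTransition.zero_of_nonpos (by norm_num), sub_zero]

lemma tendsto_integral_mul_cutoff {F : ℝ → ℝ} (hF : IntegrableOn F (Ioi 0)) :
    Tendsto (fun n => ∫ x in Ioi 0, F x * cutoff n x) atTop (𝓝 (∫ x in Ioi 0, F x)) := by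
  refine tendsto_integral_of_dominated_convergence (fun x => ‖F x‖) (fun n =>
    hF.aestronglyMeasurable.mul (contDiff_cutoff n).continuous.aestronglyMeasurable) hF.norm
    (fun n => Eventually.of_forall fun x => ?_) ?_
  · rw [norm_mul]
    exact mul_le_of_le_one_right (norm_nonneg _) (norm_cutoff_le_one n x)
  · filter_upwards [ae_restrict_mem measurableSet_Ioi] with x hx
    simpa using (tendsto_cutoff hx).const_mul (F x)

/-- The derivatives of the cutoffs are nonnegative, have mass one and concentrate at `0`, so they
act as a one-sided approximate identity. Rescaling by `n + 1` gives a fixed dominating function. -/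
lemma tendsto_integral_mul_deriv_cutoff {F : ℝ → ℝ} (hF : ContinuousOn F (Ici 0)) {C : ℝ}
    (hC : ∀ x, 0 ≤ x → ‖F x‖ ≤ C) :
    Tendsto (fun n => ∫ x in Ioi 0, F x * deriv (cutoff n) x) atTop (𝓝 (F 0)) := by
  obtain ⟨hi, h1⟩ := integrableOn_deriv_smoothTransition_and_integral_eq_one
  have key : ∀ n : ℕ, ∫ x in Ioi 0, F x * deriv (cutoff n) x =
      ∫ y in Ioi 0, F (y / (n + 1)) * deriv Real.smoothTransition (y - 1) := by
    intro n
    have hn : (0 : ℝ) < n + 1 := by positivity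
    have := integral_comp_mul_left_Ioi
      (fun y => F (y / (n + 1)) * deriv Real.smoothTransition (y - 1)) 0 hn
    rw [mul_zero, eq_inv_smul_iff₀ hn.ne'] at this
    rw [← this, smul_eq_mul, ← integral_const_mul]
    refine integral_congr_ae (Eventually.of_forall fun x => ?_)
    simp only [(hasDerivAt_cutoff n x).deriv]
    rw [mul_div_cancel_left₀ _ hn.ne']
    ring
  simp_rw [key]
  have hlim : F 0 = ∫ y in Ioi (0 : ℝ), F 0 * deriv Real.smoothTransition (y - 1) := by
    rw [integral_const_mul, h1, mul_one]
  rw [hlim]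
  refine tendsto_integral_of_dominated_convergence
    (fun y => C * deriv Real.smoothTransition (y - 1)) (fun n => ?_) (hi.const_mul C)
    (fun n => ?_) ?_
  · refine ContinuousOn.aestronglyMeasurable (ContinuousOn.mul ?_ ?_) measurableSet_Ioi
    · exact hF.comp (by fun_prop) fun y hy => div_nonneg (mem_Ioi.1 hy).le (by positivity)
    · exact (continuous_deriv_smoothTransition.comp (by fun_prop)).continuousOn
  · filter_upwards [ae_restrict_mem measurableSet_Ioi] with y hy
    rw [norm_mul, Real.norm_of_nonneg (deriv_smoothTransition_nonneg _)]
    exact mul_le_mul_of_nonneg_right (hC _ (div_nonneg (mem_Ioi.1 hy).le (by positivity)))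
      (deriv_smoothTransition_nonneg _)
  · filter_upwards [ae_restrict_mem measurableSet_Ioi] with y hy
    refine Tendsto.mul_const _ ?_
    have h0 : Tendsto F (𝓝[Ici 0] 0) (𝓝 (F 0)) := hF 0 self_mem_Ici
    refine h0.comp (tendsto_nhdsWithin_iff.2 ⟨?_, Eventually.of_forall fun n =>
      div_nonneg (mem_Ioi.1 hy).le (by positivity)⟩)
    simpa using (tendsto_one_div_add_atTop_nhds_zero_nat (𝕜 := ℝ)).const_mul y |>.congr
      fun n => by rw [mul_one_div]

/-- Integration by parts for a function continuous up to `0` with a weak derivative on `(0, ∞)`,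
against test functions that need not vanish at `0`. -/
lemma integral_mul_deriv_eq_of_weakDeriv {a b : ℝ → ℝ} (ha : ContinuousOn a (Ici 0))
    (hb : ∀ R, IntegrableOn b (Ioc 0 R))
    (h : ∀ φ : ℝ → ℝ, ContDiff ℝ ∞ φ → HasCompactSupport φ → tsupport φ ⊆ Ioi 0 →
      ∫ x in Ioi 0, a x * deriv φ x = -∫ x in Ioi 0, b x * φ x)
    {φ : ℝ → ℝ} (hφ : ContDiff ℝ ∞ φ) (hφc : HasCompactSupport φ) :
    ∫ x in Ioi 0, a x * deriv φ x = -(a 0 * φ 0) - ∫ x in Ioi 0, b x * φ x := by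
  have hφ' : Continuous (deriv φ) := hφ.continuous_deriv (by simp)
  have ib := integrableOn_Ioi_mul hb hφ.continuous hφc
  have ia := integrableOn_Ioi_mul ha.integrableOn_Ioc_zero hφ' hφc.deriv
  obtain ⟨C, hC⟩ := exists_bound_mul ha hφ.continuous hφc
  have t1 := tendsto_integral_mul_cutoff ia
  have t2 := tendsto_integral_mul_cutoff ib
  have t3 := tendsto_integral_mul_deriv_cutoff (ha.mul hφ.continuous.continuousOn) hC
  -- The product with the cutoff is an admissible test function. The term in which the cutoff is
  -- differentiated becomes the boundary value `a 0 * φ 0` in the limit.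
  have e : ∀ n, (∫ x in Ioi 0, a x * deriv φ x * cutoff n x) +
      (∫ x in Ioi 0, (a x * φ x) * deriv (cutoff n) x) =
      -∫ x in Ioi 0, b x * φ x * cutoff n x := by
    intro n
    have hχ := contDiff_cutoff n
    have hχ' : Continuous (deriv (cutoff n)) := hχ.continuous_deriv (by simp)
    have hn := h (fun x => φ x * cutoff n x) (hφ.mul hχ) hφc.mul_right
      (tsupport_mul_cutoff_subset φ n)
    simp_rw [mul_assoc]
    rw [← integral_add, ← hn]
    · refine integral_congr_ae (Eventually.of_forall fun x => ?_)
      have hd : deriv (fun x => φ x * cutoff n x) x =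
          deriv φ x * cutoff n x + φ x * deriv (cutoff n) x :=
        deriv_fun_mul (hφ.differentiable (by simp) x) (hχ.differentiable (by simp) x)
      simp only [hd]
      ring
    · exact integrableOn_Ioi_mul ha.integrableOn_Ioc_zero (hφ'.mul hχ.continuous)
        hφc.deriv.mul_right
    · exact integrableOn_Ioi_mul ha.integrableOn_Ioc_zero (hφ.continuous.mul hχ')
        hφc.mul_right
  have := tendsto_nhds_unique ((t1.add t3).congr e) t2.neg
  simp only [Pi.mul_apply] at this
  linarith

/-! ### The kernel against derivatives of order `r` -/

lemma _root_.MeasureTheory.MemLp.integrableOn_Ioc_zero {H : ℝ → ℝ} (hH : MemLp H 2 halfLine)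
    (R : ℝ) : IntegrableOn H (Ioc 0 R) := by
  have : MemLp H 2 (volume.restrict (Ioc 0 R)) :=
    hH.mono_measure (Measure.restrict_mono Ioc_subset_Ioi_self le_rfl)
  have : IsFiniteMeasure (volume.restrict (Ioc (0 : ℝ) R)) :=
    ⟨by simp⟩
  exact MemLp.integrable (q := 2) (by norm_num) ‹_›

lemma _root_.MeasureTheory.LocallyIntegrableOn.integrable_smul_of_tsupport_subset {u φ : ℝ → ℝ}
    {U : Set ℝ} (hu : LocallyIntegrableOn u U volume) (hφ : Continuous φ)
    (hφc : HasCompactSupport φ) (hφs : tsupport φ ⊆ U) : Integrable fun x => φ x • u x := by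
  obtain ⟨C, hC⟩ := hφ.bounded_above_of_compact_support hφc
  have h1 : IntegrableOn (fun x => φ x • u x) (tsupport φ) :=
    (hu.integrableOn_compact_subset hφs hφc.isCompact).bdd_mul hφ.aestronglyMeasurable
      (Eventually.of_forall hC)
  refine (integrableOn_iff_integrable_of_support_subset fun x hx => subset_tsupport φ ?_).1 h1
  exact left_ne_zero_of_mul hx

/-- This is the fundamental lemma of the calculus of variations. It starts the induction on the
order, where the continuous version of `g` is known only through test functions. -/
lemma HasWeakDeriv.ae_eq_of_zero {f h : ℝ → ℝ} (hfh : HasWeakDeriv 0 f h) :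
    ∀ᵐ x ∂(volume.restrict (Ioi 0)), f x = h x := by
  have h0 := isOpen_Ioi.ae_eq_zero_of_integral_contDiff_smul_eq_zero (μ := volume)
    (hfh.1.sub hfh.2.1) (fun φ hφ hφc hφs => by
      have e := hfh.2.2 φ hφ hφc hφs
      have i1 := hfh.1.integrable_smul_of_tsupport_subset hφ.continuous hφc hφs
      have i2 := hfh.2.1.integrable_smul_of_tsupport_subset hφ.continuous hφc hφs
      have hz : ∀ (u : ℝ → ℝ), ∫ x, φ x • u x = ∫ x in Ioi 0, u x * φ x := fun u => by
        rw [← setIntegral_eq_integral_of_forall_compl_eq_zero (s := Ioi 0)]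
        · simp_rw [smul_eq_mul, mul_comm]
        · intro x hx
          rw [image_eq_zero_of_notMem_tsupport fun hx' => hx (hφs hx'), zero_smul]
      simp only [Pi.sub_apply, smul_sub]
      rw [integral_sub i1 i2, hz, hz]
      simpa [sub_eq_zero] using e)
  rw [ae_restrict_iff' measurableSet_Ioi]
  filter_upwards [h0] with x hx hx0
  simpa [sub_eq_zero] using hx hx0

/-- Integration by parts for the kernel: `∫ g φ^{(r)} = (-1)^r (B φ(0) + ∫ g^{(r)} φ)`. -/
lemma KernelCond.exists_integral_mul_iteratedDeriv {r ν : ℕ} {g : ℝ → ℝ} (hr : 1 ≤ r)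
    (hg : KernelCond r g) (hν : r ≤ ν) (hg₂ : MemSobolev ν 2 g) :
    ∃ (B : ℝ) (H : ℝ → ℝ), MemLp H 2 halfLine ∧
      ∀ φ : ℝ → ℝ, ContDiff ℝ ∞ φ → HasCompactSupport φ →
        ∫ x in Ioi 0, g x * iteratedDeriv r φ x =
          (-1) ^ r * (B * φ 0 + ∫ x in Ioi 0, H x * φ x) := by
  obtain ⟨hg0, B, -, hB⟩ := hg
  obtain ⟨H, hH, hH2⟩ := hg₂.2 r hν
  refine ⟨B, H, hH2, ?_⟩
  have step : ∀ (j : ℕ) (a b : ℝ → ℝ), HasWeakDeriv j g a → HasWeakDeriv (j + 1) g b →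
      ∀ φ : ℝ → ℝ, ContDiff ℝ ∞ φ → HasCompactSupport φ → tsupport φ ⊆ Ioi 0 →
      ∫ x in Ioi 0, a x * deriv φ x = -∫ x in Ioi 0, b x * φ x := by
    intro j a b ha hb φ hφ hφc hφs
    have e1 := ha.2.2 (deriv φ) (contDiff_infty_iff_deriv.1 hφ).2 hφc.deriv
      (Subset.trans tsupport_deriv_subset hφs)
    have e2 := hb.2.2 φ hφ hφc hφs
    rw [iteratedDeriv_succ', e1, pow_succ, mul_assoc] at e2
    simpa using mul_left_cancel₀ (pow_ne_zero j (by norm_num)) e2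
  -- Below order `r` no boundary term appears: each step picks up the value at `0` of a derivative
  -- of order at most `r - 2`, which is zero. Only the last integration by parts contributes `B
  -- φ(0)`.
  have main : ∀ (j : ℕ), j < r → ∀ a : ℝ → ℝ, HasWeakDeriv j g a → ContinuousOn a (Ici 0) →
      ∀ φ : ℝ → ℝ, ContDiff ℝ ∞ φ → HasCompactSupport φ →
      ∫ x in Ioi 0, g x * iteratedDeriv j φ x = (-1) ^ j * ∫ x in Ioi 0, a x * φ x := by
    intro j
    induction j with
    | zero =>
      intro _ a ha _ φ _ _
      rw [pow_zero, one_mul, iteratedDeriv_zero]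
      refine integral_congr_ae ?_
      filter_upwards [ha.ae_eq_of_zero] with x hx
      rw [hx]
    | succ j ih =>
      intro hj b hb hbc φ hφ hφc
      obtain ⟨a, ha, hac, ha0⟩ := hg0 j hj
      rw [iteratedDeriv_succ', ih (by omega) a ha hac _ (contDiff_infty_iff_deriv.1 hφ).2
        hφc.deriv, integral_mul_deriv_eq_of_weakDeriv hac hbc.integrableOn_Ioc_zero
        (step j a b ha hb) hφ hφc, ha0]
      ring
  intro φ hφ hφc
  obtain ⟨s, rfl⟩ : ∃ s, r = s + 1 := ⟨r - 1, by omega⟩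
  obtain ⟨a, ha, hac, ha0⟩ := hB
  rw [Nat.add_sub_cancel] at ha
  rw [iteratedDeriv_succ', main s (by omega) a ha hac _ (contDiff_infty_iff_deriv.1 hφ).2
    hφc.deriv, integral_mul_deriv_eq_of_weakDeriv hac hH2.integrableOn_Ioc_zero
    (step s a H ha hH) hφ hφc, ha0]
  ring

/-- The convolution of the kernel with an `r`-th derivative. -/
lemma KernelCond.exists_laplaceConv_iteratedDeriv {r ν : ℕ} {g : ℝ → ℝ} (hr : 1 ≤ r)
    (hg : KernelCond r g) (hν : r ≤ ν) (hg₂ : MemSobolev ν 2 g) :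
    ∃ (B : ℝ) (H : ℝ → ℝ), MemLp H 2 halfLine ∧
      ∀ ψ : ℝ → ℝ, ContDiff ℝ ∞ ψ → HasCompactSupport ψ → tsupport ψ ⊆ Ici 0 → ∀ u, 0 ≤ u →
        laplaceConv g (iteratedDeriv r ψ) u = B * ψ u + ∫ x in Ioi 0, H x * ψ (u - x) := by
  obtain ⟨B, H, hH, h⟩ := hg.exists_integral_mul_iteratedDeriv hr hν hg₂
  refine ⟨B, H, hH, fun ψ hψ hψc hψs u hu => ?_⟩
  -- Causality: the integrand vanishes for `x ≥ u`, so the integral over the half-line equals the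
  -- convolution over `[0, u]`.
  have h0 : ∀ y, y ≤ 0 → iteratedDeriv r ψ y = 0 := by
    have hlt : ∀ y ∈ Iio (0 : ℝ), iteratedDeriv r ψ y = 0 := fun y hy =>
      image_eq_zero_of_notMem_tsupport fun hy' =>
        not_le.2 (mem_Iio.1 hy) (mem_Ici.1 (hψs (tsupport_iteratedDeriv_subset ψ r hy')))
    intro y hy
    have hcl : IsClosed {y | iteratedDeriv r ψ y = 0} :=
      isClosed_eq (contDiff_infty_iteratedDeriv hψ r).continuous continuous_const
    have := closure_minimal hlt hcl
    rw [closure_Iio] at this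
    exact this hy
  have hcomp : HasCompactSupport fun x => ψ (u - x) :=
    hψc.comp_homeomorph (Homeomorph.subLeft u)
  have e := h (fun x => ψ (u - x)) (hψ.comp (by fun_prop)) hcomp
  simp only [iteratedDeriv_comp_const_sub, smul_eq_mul, sub_zero] at e
  have e' : ∫ x in Ioi 0, g x * ((-1) ^ r * iteratedDeriv r ψ (u - x)) =
      (-1) ^ r * ∫ x in Ioi 0, g x * iteratedDeriv r ψ (u - x) := by
    rw [← integral_const_mul]
    congr 1 with x
    ring
  rw [e'] at e
  rw [← mul_left_cancel₀ (pow_ne_zero r (by norm_num)) e, laplaceConv]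
  have hs := intervalIntegral.integral_comp_sub_left (a := 0) (b := u)
    (fun x => g x * iteratedDeriv r ψ (u - x)) u
  simp only [sub_sub_cancel, sub_self, sub_zero] at hs
  rw [hs, intervalIntegral.integral_of_le hu]
  refine (setIntegral_eq_of_subset_of_forall_sdiff_eq_zero measurableSet_Ioi
    Ioc_subset_Ioi_self fun x hx => ?_).symm
  rw [h0 _ ?_, mul_zero]
  by_contra hlt
  exact hx.2 ⟨hx.1, by linarith⟩

/-! ### Smooth compactly supported functions in the Sobolev ball -/

lemma hasWeakDeriv_iteratedDeriv {f : ℝ → ℝ} (hf : ContDiff ℝ ∞ f) (hfc : HasCompactSupport f)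
    (j : ℕ) : HasWeakDeriv j f (iteratedDeriv j f) := by
  have hcd := fun j => contDiff_infty_iteratedDeriv hf j
  have hcc := fun j => hasCompactSupport_iteratedDeriv hfc j
  refine ⟨hf.continuous.locallyIntegrable.locallyIntegrableOn _,
    (hcd j).continuous.locallyIntegrable.locallyIntegrableOn _, ?_⟩
  induction j with
  | zero => simp
  | succ j ih =>
    intro φ hφ hφc hφs
    have hφ' : ContDiff ℝ ∞ (deriv φ) := (contDiff_infty_iff_deriv.1 hφ).2
    rw [iteratedDeriv_succ', ih _ hφ' hφc.deriv (Subset.trans tsupport_deriv_subset hφs), pow_succ,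
      mul_assoc]
    congr 1
    have hz : ∀ v φ : ℝ → ℝ, tsupport φ ⊆ Ioi 0 →
        ∫ x in Ioi 0, v x * φ x = ∫ x, v x * φ x := fun v φ h =>
      setIntegral_eq_integral_of_forall_compl_eq_zero fun x hx => by
        rw [image_eq_zero_of_notMem_tsupport fun hx' => hx (h hx'), mul_zero]
    rw [hz _ _ hφs, hz _ _ (Subset.trans tsupport_deriv_subset hφs), neg_one_mul]
    have hint : ∀ u v : ℝ → ℝ, Continuous u → Continuous v → HasCompactSupport u →
        Integrable (u * v) := fun u v hu hv hc =>
      (hu.mul hv).integrable_of_hasCompactSupport hc.mul_right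
    refine integral_mul_deriv_eq_deriv_mul_of_integrable (fun x _ => ?_)
      (fun x _ => (hφ.differentiable (by simp) x).hasDerivAt)
      (hint _ _ (hcd j).continuous hφ'.continuous (hcc j))
      (hint _ _ (hcd (j + 1)).continuous hφ.continuous (hcc (j + 1)))
      (hint _ _ (hcd j).continuous hφ.continuous (hcc j))
    rw [iteratedDeriv_succ]
    exact ((hcd j).differentiable (by simp) x).hasDerivAt

lemma eLpNorm_two_sq (f : ℝ → ℝ) (μ : Measure ℝ) :
    eLpNorm f 2 μ ^ 2 = ∫⁻ x, ENNReal.ofReal (f x ^ 2) ∂μ := by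
  have := eLpNorm_nnreal_pow_eq_lintegral (f := f) (μ := μ) (p := 2) (by norm_num)
  simp only [ENNReal.coe_ofNat, NNReal.coe_ofNat, ENNReal.rpow_ofNat] at this
  rw [this]
  refine lintegral_congr fun x => ?_
  rw [← enorm_pow, Real.enorm_of_nonneg (sq_nonneg _)]

lemma _root_.Continuous.memLp_halfLine {f : ℝ → ℝ} (hf : Continuous f) (hfc : HasCompactSupport f) :
    MemLp f 2 halfLine :=
  (hf.memLp_of_hasCompactSupport (μ := volume) hfc).restrict _

lemma mem_sobolevBall_of_contDiff {f : ℝ → ℝ} (hf : ContDiff ℝ ∞ f) (hfc : HasCompactSupport f)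
    {m : ℕ} {A : ℝ}
    (h : ∑ j ∈ Finset.range (m + 1), ∫ x, iteratedDeriv j f x ^ 2 ≤ A ^ 2) :
    f ∈ sobolevBall m A := by
  have hcd := fun j => contDiff_infty_iteratedDeriv hf j
  have hcc := fun j => hasCompactSupport_iteratedDeriv hfc j
  refine ⟨⟨hf.continuous.memLp_halfLine hfc, fun j _ =>
    ⟨_, hasWeakDeriv_iteratedDeriv hf hfc j,
      (hcd j).continuous.memLp_halfLine (hcc j)⟩⟩,
    fun j => iteratedDeriv j f, fun j _ => hasWeakDeriv_iteratedDeriv hf hfc j, ?_⟩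
  refine le_trans ?_ (ENNReal.ofReal_le_ofReal h)
  rw [ENNReal.ofReal_sum_of_nonneg fun j _ => integral_nonneg fun x => sq_nonneg _]
  refine Finset.sum_le_sum fun j _ => ?_
  rw [eLpNorm_two_sq, ofReal_integral_eq_lintegral_ofReal _
    (Eventually.of_forall fun x => sq_nonneg _)]
  · exact lintegral_mono' Measure.restrict_le_self le_rfl
  · simp_rw [sq]
    exact ((hcd j).continuous.mul (hcd j).continuous).integrable_of_hasCompactSupport
      (hcc j).mul_right

/-! ### The bump profile and its tiles -/

/-- A derivative of a bump is compactly supported, so if the next one vanished identically it would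
be a constant equal to zero. -/
lemma exists_contDiff_iteratedDeriv_ne_zero (r : ℕ) :
    ∃ ψ : ℝ → ℝ, ContDiff ℝ ∞ ψ ∧ tsupport ψ ⊆ Ioo 0 1 ∧ ∃ x, iteratedDeriv r ψ x ≠ 0 := by
  let b : ContDiffBump (1 / 2 : ℝ) := ⟨1 / 8, 1 / 4, by norm_num, by norm_num⟩
  have hs : tsupport b ⊆ Ioo 0 1 := by
    rw [b.tsupport_eq, Real.closedBall_eq_Icc]
    exact Icc_subset_Ioo (by norm_num) (by norm_num)
  have hb : ContDiff ℝ ∞ b := b.contDiff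
  refine ⟨b, hb, hs, ?_⟩
  induction r with
  | zero =>
    refine ⟨1 / 2, ?_⟩
    rw [iteratedDeriv_zero, b.one_of_mem_closedBall (Metric.mem_closedBall_self (by norm_num))]
    exact one_ne_zero
  | succ r ih =>
    by_contra! h
    obtain ⟨x, hx⟩ := ih
    rw [iteratedDeriv_succ] at h
    refine hx ?_
    rw [is_const_of_deriv_eq_zero ((contDiff_infty_iteratedDeriv hb r).differentiable (by simp))
      h x 2]
    refine image_eq_zero_of_notMem_tsupport fun h2 => ?_
    have := hs (tsupport_iteratedDeriv_subset _ _ h2)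
    norm_num at this

/-- The copy of `θ` scaled to width `h` and moved to the `k`-th cell of the grid of mesh `h`. -/
noncomputable def tile (θ : ℝ → ℝ) (h : ℝ) (k : ℕ) (x : ℝ) : ℝ := θ (h⁻¹ * x - k)

section Tile

variable {θ : ℝ → ℝ} {h : ℝ}

lemma contDiff_tile (hθ : ContDiff ℝ ∞ θ) (h : ℝ) (k : ℕ) : ContDiff ℝ ∞ (tile θ h k) :=
  hθ.comp (by fun_prop)

lemma tile_eq_zero (hh : 0 < h) (hs : tsupport θ ⊆ Ioo 0 1) {k : ℕ} {x : ℝ}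
    (hx : x ∉ Ioo (h * k) (h * (k + 1))) : tile θ h k x = 0 := by
  refine image_eq_zero_of_notMem_tsupport (f := θ) fun h' => hx ?_
  obtain ⟨h1, h2⟩ := hs h'
  rw [inv_mul_eq_div] at h1 h2
  have h1' : (k : ℝ) < x / h := by linarith
  have h2' : x / h < k + 1 := by linarith
  rw [lt_div_iff₀ hh] at h1'
  rw [div_lt_iff₀ hh] at h2'
  exact ⟨by linarith, by linarith⟩

lemma cell_disjoint (hh : 0 < h) {k l : ℕ} (hkl : k ≠ l) {x : ℝ}
    (hx : x ∈ Ioo (h * k) (h * (k + 1))) : x ∉ Ioo (h * l) (h * (l + 1)) := by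
  intro hy
  have h1 : h * k < h * (l + 1) := hx.1.trans hy.2
  have h2 : h * l < h * (k + 1) := hy.1.trans hx.2
  have h1 := lt_of_mul_lt_mul_left h1 hh.le
  have h2 := lt_of_mul_lt_mul_left h2 hh.le
  norm_cast at h1 h2
  omega

lemma tile_mul_tile (hh : 0 < h) (hs : tsupport θ ⊆ Ioo 0 1) {k l : ℕ} (hkl : k ≠ l) (x : ℝ) :
    tile θ h k x * tile θ h l x = 0 := by
  by_cases hx : x ∈ Ioo (h * k) (h * (k + 1))
  · rw [tile_eq_zero hh hs (cell_disjoint hh hkl hx), mul_zero]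
  · rw [tile_eq_zero hh hs hx, zero_mul]

lemma tsupport_tile_subset (hh : 0 < h) (hs : tsupport θ ⊆ Ioo 0 1) (k : ℕ) :
    tsupport (tile θ h k) ⊆ Icc (h * k) (h * (k + 1)) := by
  refine closure_minimal (fun x hx => ?_) isClosed_Icc
  by_contra hx'
  exact hx (tile_eq_zero hh hs fun h' => hx' (Ioo_subset_Icc_self h'))

lemma hasCompactSupport_tile (hh : 0 < h) (hs : tsupport θ ⊆ Ioo 0 1) (k : ℕ) :
    HasCompactSupport (tile θ h k) :=
  isCompact_Icc.of_isClosed_subset (isClosed_tsupport _) (tsupport_tile_subset hh hs k)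

lemma iteratedDeriv_tile (hθ : ContDiff ℝ ∞ θ) (h : ℝ) (k j : ℕ) :
    iteratedDeriv j (tile θ h k) = fun x => h⁻¹ ^ j * tile (iteratedDeriv j θ) h k x := by
  have e : tile θ h k = fun x => (fun y => θ (y - k)) (h⁻¹ * x) := rfl
  have hc : ContDiff ℝ j fun y : ℝ => θ (y - k) :=
    (hθ.comp (by fun_prop)).of_le (by exact_mod_cast le_top)
  rw [e, iteratedDeriv_comp_const_mul hc, iteratedDeriv_comp_sub_const]
  rfl

lemma integral_tile_sq (hh : 0 < h) (θ : ℝ → ℝ) (k : ℕ) :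
    ∫ x, tile θ h k x ^ 2 = h * ∫ x, θ x ^ 2 := by
  have := Measure.integral_comp_mul_left (fun y => θ (y - k) ^ 2) h⁻¹
  rw [integral_sub_right_eq_self (fun y => θ y ^ 2) (k : ℝ), inv_inv, abs_of_pos hh] at this
  exact this

lemma sq_sum_eq_sum_sq {ι : Type*} (s : Finset ι) (e : ι → ℝ)
    (he : ∀ k ∈ s, ∀ l ∈ s, k ≠ l → e k * e l = 0) : (∑ k ∈ s, e k) ^ 2 = ∑ k ∈ s, e k ^ 2 := by
  rw [sq, Finset.sum_mul_sum]
  refine Finset.sum_congr rfl fun k hk => ?_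
  rw [Finset.sum_eq_single_of_mem k hk fun l hl hlk => he k hk l hl hlk.symm, sq]

lemma integrable_tile_sq (hθ : ContDiff ℝ ∞ θ) (hh : 0 < h) (hs : tsupport θ ⊆ Ioo 0 1) (k : ℕ) :
    Integrable fun x => tile θ h k x ^ 2 := by
  simp_rw [sq]
  exact ((contDiff_tile hθ h k).continuous.mul
    (contDiff_tile hθ h k).continuous).integrable_of_hasCompactSupport
      (hasCompactSupport_tile hh hs k).mul_right

/-- The test functions of the hypercube. -/
noncomputable def tileSum (θ : ℝ → ℝ) (h c : ℝ) (w : Finset ℕ) (x : ℝ) : ℝ :=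
  ∑ k ∈ w, c * tile θ h k x

lemma contDiff_tileSum (hθ : ContDiff ℝ ∞ θ) (h c : ℝ) (w : Finset ℕ) :
    ContDiff ℝ ∞ (tileSum θ h c w) :=
  ContDiff.sum fun k _ => contDiff_const.mul (contDiff_tile hθ h k)

lemma hasCompactSupport_tileSum (hh : 0 < h) (hs : tsupport θ ⊆ Ioo 0 1) (c : ℝ) (w : Finset ℕ) :
    HasCompactSupport (tileSum θ h c w) := by
  unfold tileSum
  induction w using Finset.induction_on with
  | empty => simp only [Finset.sum_empty]; exact HasCompactSupport.zero
  | insert k w hk ih =>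
    simp_rw [Finset.sum_insert hk]
    exact ((hasCompactSupport_tile hh hs k).mul_left (f := fun _ => c)).add ih

lemma iteratedDeriv_tileSum (hθ : ContDiff ℝ ∞ θ) (h c : ℝ) (w : Finset ℕ) (j : ℕ) :
    iteratedDeriv j (tileSum θ h c w) = tileSum (iteratedDeriv j θ) h (c * h⁻¹ ^ j) w := by
  ext x
  have hc := fun k => ((contDiff_tile hθ h k).contDiffAt (x := x)).of_le
    (show (j : WithTop ℕ∞) ≤ (⊤ : ℕ∞) by exact_mod_cast le_top)
  unfold tileSum
  rw [iteratedDeriv_fun_sum fun k _ => contDiffAt_const.mul (hc k)]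
  refine Finset.sum_congr rfl fun k _ => ?_
  rw [iteratedDeriv_const_mul c (hc k), iteratedDeriv_tile hθ, mul_assoc]

lemma integral_tileSum_sq (hθ : ContDiff ℝ ∞ θ) (hh : 0 < h) (hs : tsupport θ ⊆ Ioo 0 1) (c : ℝ)
    (w : Finset ℕ) :
    ∫ x, tileSum θ h c w x ^ 2 = w.card * (c ^ 2 * h * ∫ x, θ x ^ 2) := by
  have e : ∀ x, tileSum θ h c w x ^ 2 = ∑ k ∈ w, c ^ 2 * tile θ h k x ^ 2 := fun x => by
    rw [tileSum, sq_sum_eq_sum_sq]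
    · simp_rw [mul_pow]
    · intro k _ l _ hkl
      linear_combination c ^ 2 * tile_mul_tile hh hs hkl x
  simp_rw [e]
  rw [integral_finsetSum _ fun k _ => (integrable_tile_sq hθ hh hs k).const_mul _]
  simp_rw [integral_const_mul, integral_tile_sq hh]
  rw [Finset.sum_const, nsmul_eq_mul]
  ring

/-- Disjointness makes the squared norms add up over tiles, and `h ≤ 1` lets the scaling factor of
order `m` dominate all lower ones. -/
lemma tileSum_mem_sobolevBall (hθ : ContDiff ℝ ∞ θ) (hh : 0 < h) (h1 : h ≤ 1)
    (hs : tsupport θ ⊆ Ioo 0 1) {c A : ℝ} {w : Finset ℕ} {m M : ℕ} (hw : w.card ≤ M)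
    (hc : M * (c ^ 2 * h) * h⁻¹ ^ (2 * m) *
      ∑ j ∈ Finset.range (m + 1), ∫ x, iteratedDeriv j θ x ^ 2 ≤ A ^ 2) :
    tileSum θ h c w ∈ sobolevBall m A := by
  refine mem_sobolevBall_of_contDiff (contDiff_tileSum hθ h c w)
    (hasCompactSupport_tileSum hh hs c w) (le_trans ?_ hc)
  rw [Finset.mul_sum]
  refine Finset.sum_le_sum fun j hj => ?_
  have hI : 0 ≤ ∫ x, iteratedDeriv j θ x ^ 2 := integral_nonneg fun x => sq_nonneg _
  rw [iteratedDeriv_tileSum hθ, integral_tileSum_sq (contDiff_infty_iteratedDeriv hθ j) hh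
    ((tsupport_iteratedDeriv_subset θ j).trans hs)]
  have hpow : (h⁻¹ ^ j) ^ 2 ≤ h⁻¹ ^ (2 * m) := by
    rw [← pow_mul, mul_comm]
    exact pow_le_pow_right₀ ((one_le_inv₀ hh).2 h1) (by rw [Finset.mem_range] at hj; omega)
  have hw' : (w.card : ℝ) ≤ M := by exact_mod_cast hw
  calc _ = w.card * (c ^ 2 * h) * (h⁻¹ ^ j) ^ 2 * ∫ x, iteratedDeriv j θ x ^ 2 := by ring
    _ ≤ _ := by gcongr

end Tile

/-! ### Energy of the convolved tiles -/

/-- Bessel's inequality for functions with pairwise disjoint supports. -/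
lemma sum_sq_integral_mul_le {ι : Type*} (s : Finset ι) {μ : Measure ℝ} {H : ℝ → ℝ}
    {e : ι → ℝ → ℝ} (hH : MemLp H 2 μ) (he : ∀ k, MemLp (e k) 2 μ) {N : ℝ} (hN : 0 < N)
    (hdisj : ∀ k l, k ≠ l → ∀ x, e k x * e l x = 0) (hnorm : ∀ k, ∫ x, e k x ^ 2 ∂μ ≤ N) :
    ∑ k ∈ s, (∫ x, H x * e k x ∂μ) ^ 2 ≤ N * ∫ x, H x ^ 2 ∂μ := by
  set p := fun k => ∫ x, H x * e k x ∂μ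
  have hHe : ∀ k, Integrable (fun x => H x * e k x) μ := fun k => hH.integrable_mul (he k)
  -- This is the expansion of `(N H - ∑ p_k e_k)² ≥ 0`; disjointness removes the cross terms.
  have hpt : ∀ x, 0 ≤ N ^ 2 * H x ^ 2 - ∑ k ∈ s, 2 * N * p k * (H x * e k x) +
      ∑ k ∈ s, p k ^ 2 * e k x ^ 2 := by
    intro x
    have e1 : (∑ k ∈ s, p k * e k x) ^ 2 = ∑ k ∈ s, p k ^ 2 * e k x ^ 2 := by
      rw [sq_sum_eq_sum_sq]
      · simp_rw [mul_pow]
      · intro k _ l _ hkl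
        linear_combination p k * p l * hdisj k l hkl x
    have e2 : ∑ k ∈ s, 2 * N * p k * (H x * e k x) = 2 * N * H x * ∑ k ∈ s, p k * e k x := by
      rw [Finset.mul_sum]
      exact Finset.sum_congr rfl fun k _ => by ring
    rw [← e1, e2]
    nlinarith [sq_nonneg (N * H x - ∑ k ∈ s, p k * e k x)]
  have hint := integral_nonneg (μ := μ) (Pi.le_def.2 hpt)
  have i1 : Integrable (fun x => N ^ 2 * H x ^ 2) μ := hH.integrable_sq.const_mul _
  have i2 : Integrable (fun x => ∑ k ∈ s, 2 * N * p k * (H x * e k x)) μ :=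
    integrable_finsetSum _ fun k _ => (hHe k).const_mul _
  have i3 : Integrable (fun x => ∑ k ∈ s, p k ^ 2 * e k x ^ 2) μ :=
    integrable_finsetSum _ fun k _ => (he k).integrable_sq.const_mul _
  have i12 : Integrable (fun x => N ^ 2 * H x ^ 2 - ∑ k ∈ s, 2 * N * p k * (H x * e k x)) μ :=
    i1.sub i2
  rw [integral_add i12 i3, integral_sub i1 i2, integral_const_mul,
    integral_finsetSum _ fun k _ => (hHe k).const_mul _,
    integral_finsetSum _ fun k _ => (he k).integrable_sq.const_mul _] at hint
  simp_rw [integral_const_mul] at hint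
  have h1 : ∑ k ∈ s, 2 * N * p k * ∫ x, H x * e k x ∂μ = 2 * N * ∑ k ∈ s, p k ^ 2 := by
    rw [Finset.mul_sum]
    exact Finset.sum_congr rfl fun k _ => by simp only [p]; ring
  have h2 : ∑ k ∈ s, p k ^ 2 * ∫ x, e k x ^ 2 ∂μ ≤ N * ∑ k ∈ s, p k ^ 2 := by
    rw [Finset.mul_sum]
    refine Finset.sum_le_sum fun k _ => ?_
    nlinarith [mul_le_mul_of_nonneg_left (hnorm k) (sq_nonneg (p k))]
  rw [h1] at hint
  refine le_of_mul_le_mul_left (a := N) ?_ hN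
  nlinarith

/-- The images of the tiles under the kernel have bounded overlap energy. -/
lemma KernelCond.exists_sum_laplaceConv_tile_sq_le {r ν : ℕ} {g : ℝ → ℝ} (hr : 1 ≤ r)
    (hg : KernelCond r g) (hν : r ≤ ν) (hg₂ : MemSobolev ν 2 g) {ψ : ℝ → ℝ}
    (hψ : ContDiff ℝ ∞ ψ) (hs : tsupport ψ ⊆ Ioo 0 1) :
    ∃ K : ℝ, 0 < K ∧ ∀ h, 0 < h → h ≤ 1 → ∀ (M : ℕ) (u : ℝ), 0 ≤ u →
      ∑ k ∈ Finset.range M, laplaceConv g (tile (iteratedDeriv r ψ) h k) u ^ 2 ≤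
        K * h ^ (2 * r) := by
  obtain ⟨B, H, hH, hconv⟩ := hg.exists_laplaceConv_iteratedDeriv hr hν hg₂
  have hψc : HasCompactSupport ψ :=
    isCompact_Icc.of_isClosed_subset (isClosed_tsupport _) (hs.trans Ioo_subset_Icc_self)
  obtain ⟨S, hS⟩ := hψ.continuous.bounded_above_of_compact_support hψc
  set N := ∫ x, ψ x ^ 2
  have hN : 0 ≤ N := integral_nonneg fun x => sq_nonneg _
  set I := ∫ x, H x ^ 2 ∂halfLine
  have hI : 0 ≤ I := integral_nonneg fun x => sq_nonneg _
  refine ⟨2 * (B ^ 2 * S ^ 2 + (N + 1) * I) + 1, by positivity, fun h hh h1 M u hu => ?_⟩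
  have hq : ∀ k, laplaceConv g (tile (iteratedDeriv r ψ) h k) u =
      h ^ r * (B * tile ψ h k u + ∫ x in Ioi 0, H x * tile ψ h k (u - x)) := by
    intro k
    -- Undoing `r` derivatives at scale `h` costs `h ^ r`, which is the smoothing gain.
    have e : tile (iteratedDeriv r ψ) h k = iteratedDeriv r fun x => h ^ r * tile ψ h k x := by
      ext x
      rw [iteratedDeriv_const_mul_field, iteratedDeriv_tile hψ]
      rw [← mul_assoc, ← mul_pow, mul_inv_cancel₀ hh.ne', one_pow, one_mul]
    rw [e, hconv _ (contDiff_const.mul (contDiff_tile hψ h k))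
      ((hasCompactSupport_tile hh hs k).mul_left (f := fun _ => h ^ r)) ?_ u hu, mul_add,
      ← integral_const_mul]
    · congr 1
      · ring
      · congr 1 with x
        ring
    · refine (tsupport_mul_subset_right (f := fun _ => h ^ r)).trans
        ((tsupport_tile_subset hh hs k).trans fun x hx => ?_)
      exact (by positivity : (0 : ℝ) ≤ h * k).trans hx.1
  have hc : ∀ k, Continuous fun x => tile ψ h k (u - x) := fun k =>
    (contDiff_tile hψ h k).continuous.comp (by fun_prop)
  have hcs : ∀ k, HasCompactSupport fun x => tile ψ h k (u - x) := fun k =>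
    (hasCompactSupport_tile hh hs k).comp_homeomorph (Homeomorph.subLeft u)
  have hbessel : ∑ k ∈ Finset.range M, (∫ x in Ioi 0, H x * tile ψ h k (u - x)) ^ 2 ≤
      (h * (N + 1)) * I := by
    refine sum_sq_integral_mul_le _ hH (e := fun k x => tile ψ h k (u - x))
      (fun k => (hc k).memLp_halfLine (hcs k)) (by positivity)
      (fun k l hkl x => tile_mul_tile hh hs hkl (u - x)) fun k => ?_
    have hle : ∫ x in Ioi 0, tile ψ h k (u - x) ^ 2 ≤ ∫ x, tile ψ h k (u - x) ^ 2 :=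
      setIntegral_le_integral ((integrable_tile_sq hψ hh hs k).comp_sub_left u)
        (Eventually.of_forall fun x => sq_nonneg _)
    rw [integral_sub_left_eq_self (fun x => tile ψ h k x ^ 2) volume u, integral_tile_sq hh] at hle
    exact hle.trans (by nlinarith)
  -- At most one tile is nonzero at `u`, so the bound does not depend on `M`.
  have hpt : ∑ k ∈ Finset.range M, tile ψ h k u ^ 2 ≤ S ^ 2 := by
    by_cases hex : ∃ k ∈ Finset.range M, tile ψ h k u ≠ 0
    · obtain ⟨k, hk, hk0⟩ := hex
      rw [Finset.sum_eq_single_of_mem k hk]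
      · exact sq_le_sq' (abs_le.1 (hS _)).1 (abs_le.1 (hS _)).2
      · intro l _ hlk
        rw [(mul_eq_zero.1 (tile_mul_tile hh hs hlk u)).resolve_right hk0, sq, mul_zero]
    · push Not at hex
      rw [Finset.sum_eq_zero fun k hk => by rw [hex k hk, sq, mul_zero]]
      positivity
  calc ∑ k ∈ Finset.range M, laplaceConv g (tile (iteratedDeriv r ψ) h k) u ^ 2
      ≤ ∑ k ∈ Finset.range M, h ^ (2 * r) * (2 * (B ^ 2 * tile ψ h k u ^ 2 +
          (∫ x in Ioi 0, H x * tile ψ h k (u - x)) ^ 2)) := by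
        refine Finset.sum_le_sum fun k _ => ?_
        rw [hq, mul_pow, ← pow_mul, mul_comm r 2]
        refine mul_le_mul_of_nonneg_left ?_ (by positivity)
        nlinarith [sq_nonneg (B * tile ψ h k u - ∫ x in Ioi 0, H x * tile ψ h k (u - x))]
    _ = h ^ (2 * r) * (2 * (B ^ 2 * ∑ k ∈ Finset.range M, tile ψ h k u ^ 2 +
          ∑ k ∈ Finset.range M, (∫ x in Ioi 0, H x * tile ψ h k (u - x)) ^ 2)) := by
        simp only [Finset.mul_sum, ← Finset.sum_add_distrib]
    _ ≤ h ^ (2 * r) * (2 * (B ^ 2 * S ^ 2 + (N + 1) * I) + 1) := by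
        refine mul_le_mul_of_nonneg_left ?_ (by positivity)
        have := mul_le_mul_of_nonneg_left hpt (sq_nonneg B)
        have : h * ((N + 1) * I) ≤ (N + 1) * I := mul_le_of_le_one_left (by positivity) h1
        linarith
    _ = _ := mul_comm _ _

/-! ### Assouad's argument on the hypercube -/

lemma laplaceConv_tileSum_insert {g : ℝ → ℝ} (hg : MemLp g 2 halfLine) {θ : ℝ → ℝ}
    (hθ : Continuous θ) {u : ℝ} (hu : 0 ≤ u) (h c : ℝ) {w : Finset ℕ} {k : ℕ} (hk : k ∉ w) :
    laplaceConv g (tileSum θ h c (insert k w)) u - laplaceConv g (tileSum θ h c w) u =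
      c * laplaceConv g (tile θ h k) u := by
  have hgi : IntervalIntegrable (fun τ => g (u - τ)) volume 0 u := by
    have : IntervalIntegrable g volume 0 u :=
      (intervalIntegrable_iff_integrableOn_Ioc_of_le hu).2 (hg.integrableOn_Ioc_zero u)
    simpa using (this.comp_sub_left u).symm
  have ht : ∀ k, Continuous (tile θ h k) := fun k => hθ.comp (by fun_prop)
  have hts : Continuous (tileSum θ h c w) := continuous_finsetSum _ fun k _ =>
    continuous_const.mul (ht k)
  unfold laplaceConv
  rw [← intervalIntegral.integral_const_mul, sub_eq_iff_eq_add,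
    ← intervalIntegral.integral_add ((hgi.mul_continuousOn (ht k).continuousOn).const_mul c)
    (hgi.mul_continuousOn hts.continuousOn)]
  congr 1 with τ
  simp only [tileSum, Finset.sum_insert hk]
  ring

/-- Loss of the estimator `F` on the `k`-th cell when the coefficient of the tile is `b`. -/
noncomputable def cellLoss {n : ℕ} (F : Estimator n) (θ : ℝ → ℝ) (h c : ℝ) (k : ℕ) (b : ℝ)
    (y : Fin n → ℝ) : ℝ≥0∞ :=
  ∫⁻ x in Ioo (h * k) (h * (k + 1)), ENNReal.ofReal ((F.1 y x - b * (c * tile θ h k x)) ^ 2)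

section

variable {n : ℕ} (F : Estimator n) {θ : ℝ → ℝ} {h : ℝ}

lemma measurable_cellLoss (hθ : ContDiff ℝ ∞ θ) (h c : ℝ) (k : ℕ) (b : ℝ) :
    Measurable (cellLoss F θ h c k b) := by
  have ht : Measurable (tile θ h k) := (contDiff_tile hθ h k).continuous.measurable
  have hF : Measurable fun p : (Fin n → ℝ) × ℝ => F.1 p.1 p.2 := F.2
  exact Measurable.lintegral_prod_right'
    (f := fun (p : (Fin n → ℝ) × ℝ) => ENNReal.ofReal
      ((F.1 p.1 p.2 - b * (c * tile θ h k p.2)) ^ 2)) (by fun_prop)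

/-- Pointwise, `z² + (z - v)² ≥ v²/2`: no estimate is close to both coefficient values. -/
lemma le_cellLoss_add_cellLoss (hθ : ContDiff ℝ ∞ θ) (hh : 0 < h) (hs : tsupport θ ⊆ Ioo 0 1)
    (c : ℝ) (k : ℕ) (y : Fin n → ℝ) :
    ENNReal.ofReal (c ^ 2 / 2 * (h * ∫ x, θ x ^ 2)) ≤
      cellLoss F θ h c k 0 y + cellLoss F θ h c k 1 y := by
  have hFy : Measurable (F.1 y) := F.2.comp measurable_prodMk_left
  have ht : Measurable (tile θ h k) := (contDiff_tile hθ h k).continuous.measurable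
  rw [cellLoss, cellLoss, ← lintegral_add_left (by fun_prop)]
  have e : c ^ 2 / 2 * (h * ∫ x, θ x ^ 2) =
      ∫ x in Ioo (h * k) (h * (k + 1)), c ^ 2 / 2 * tile θ h k x ^ 2 := by
    rw [integral_const_mul, setIntegral_eq_integral_of_forall_compl_eq_zero fun x hx => by
      rw [tile_eq_zero hh hs hx, sq, mul_zero], integral_tile_sq hh]
  rw [e, ofReal_integral_eq_lintegral_ofReal ((integrable_tile_sq hθ hh hs k).restrict.const_mul _)
    (Eventually.of_forall fun x => by positivity)]
  refine lintegral_mono fun x => ?_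
  rw [← ENNReal.ofReal_add (sq_nonneg _) (sq_nonneg _)]
  refine ENNReal.ofReal_le_ofReal ?_
  nlinarith [sq_nonneg (2 * F.1 y x - c * tile θ h k x)]

/-- The cells are disjoint subsets of `[0, T]`, and on each of them only its own tile can be
nonzero, so the loss splits. -/
lemma sum_cellLoss_le_risk (hθ : ContDiff ℝ ∞ θ) (hh : 0 < h) (hs : tsupport θ ⊆ Ioo 0 1)
    (g : ℝ → ℝ) (σ : ℝ) (t : Fin n → ℝ) {T : ℝ} (c : ℝ) {S : Finset ℕ}
    (hS : ∀ k ∈ S, h * (k + 1) ≤ T) (w : Finset ℕ) :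
    ∑ k ∈ S, ∫⁻ y, cellLoss F θ h c k (if k ∈ w then 1 else 0) y
        ∂(dataLaw g σ t (tileSum θ h c w)) ≤
      risk g σ t (Icc 0 T) F (tileSum θ h c w) := by
  rw [← lintegral_finsetSum _ fun k _ => measurable_cellLoss F hθ h c k _, risk]
  refine lintegral_mono fun y => ?_
  have hsub : (⋃ k ∈ S, Ioo (h * k) (h * (k + 1))) ⊆ Icc 0 T := by
    simp only [iUnion_subset_iff]
    intro k hk x hx
    exact ⟨(by positivity : 0 ≤ h * k).trans hx.1.le, hx.2.le.trans (hS k hk)⟩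
  rw [eLpNorm_two_sq]
  refine le_trans (le_of_eq ?_) (lintegral_mono_set hsub)
  rw [lintegral_biUnion_finset _ fun k _ => measurableSet_Ioo]
  · refine Finset.sum_congr rfl fun k _ => ?_
    refine setLIntegral_congr_fun measurableSet_Ioo fun x hx => ?_
    have hz : ∀ l, l ≠ k → c * tile θ h l x = 0 := fun l hlk => by
      rw [tile_eq_zero hh hs (cell_disjoint hh hlk.symm hx), mul_zero]
    have hval : tileSum θ h c w x = (if k ∈ w then 1 else 0) * (c * tile θ h k x) := by
      split_ifs with hk
      · rw [one_mul]
        exact Finset.sum_eq_single_of_mem k hk fun l _ hl => hz l hl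
      · rw [zero_mul]
        exact Finset.sum_eq_zero fun l hl => hz l fun hlk => hk (hlk ▸ hl)
    simp only [hval]
  · intro k _ l _ hkl
    exact disjoint_left.2 fun x hx => cell_disjoint hh hkl hx

/-- Assouad's lower bound over the hypercube of tiles. -/
lemma le_of_risk_tileSum_le {g : ℝ → ℝ} (hg : MemLp g 2 halfLine) (hθ : ContDiff ℝ ∞ θ)
    (hh : 0 < h) (hs : tsupport θ ⊆ Ioo 0 1) {σ : ℝ} (hσ : 0 < σ) {t : Fin n → ℝ}
    (ht : ∀ i, 0 ≤ t i) {T c : ℝ} {S : Finset ℕ} (hS : ∀ k ∈ S, h * (k + 1) ≤ T)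
    (hclose : ∀ k ∈ S, ∑ i, (c * laplaceConv g (tile θ h k) (t i)) ^ 2 ≤
      σ ^ 2 * Real.log (5 / 4))
    {U : ℝ≥0∞} (hU : ∀ w ⊆ S, risk g σ t (Icc 0 T) F (tileSum θ h c w) ≤ U) :
    ENNReal.ofReal (S.card * (c ^ 2 * h * ∫ x, θ x ^ 2) / 8) ≤ U := by
  set D := c ^ 2 / 2 * (h * ∫ x, θ x ^ 2) with hDdef
  have hI : 0 ≤ ∫ x, θ x ^ 2 := integral_nonneg fun x => sq_nonneg _
  have hD : 0 ≤ D := by positivity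
  let G : ℕ → Finset ℕ → ℝ≥0∞ := fun k w =>
    ∫⁻ y, cellLoss F θ h c k (if k ∈ w then 1 else 0) y ∂(dataLaw g σ t (tileSum θ h c w))
  -- Pair each `w` not containing `k` with `insert k w`. The two regression functions differ by one
  -- tile, so the two-point bound applies to each of the `2 ^ (S.card - 1)` pairs.
  have hk : ∀ k ∈ S, 2 ^ (S.card - 1) * ENNReal.ofReal (D / 2) ≤ ∑ w ∈ S.powerset, G k w := by
    intro k hkS
    have hke : k ∉ S.erase k := Finset.notMem_erase k S
    rw [← Finset.insert_erase hkS, Finset.sum_powerset_insert hke, ← Finset.sum_add_distrib,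
      Finset.card_insert_of_notMem hke, Nat.add_sub_cancel]
    have hcard : (2 : ℝ≥0∞) ^ (S.erase k).card * ENNReal.ofReal (D / 2) =
        ∑ _w ∈ (S.erase k).powerset, ENNReal.ofReal (D / 2) := by
      rw [Finset.sum_const, Finset.card_powerset, nsmul_eq_mul]
      push_cast
      rfl
    rw [hcard]
    refine Finset.sum_le_sum fun w hw => ?_
    have hkw : k ∉ w := fun h' => hke (Finset.mem_powerset.1 hw h')
    simp only [G, if_neg hkw, Finset.mem_insert_self, if_true]
    refine two_point_dataLaw g hσ t _ _ ?_ (measurable_cellLoss F hθ h c k 0)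
      (measurable_cellLoss F hθ h c k 1) hD (le_cellLoss_add_cellLoss F hθ hh hs c k)
    simp_rw [laplaceConv_tileSum_insert hg hθ.continuous (ht _) h c hkw]
    exact hclose k hkS
  have hle : ∑ k ∈ S, ∑ w ∈ S.powerset, G k w ≤ 2 ^ S.card * U := by
    rw [Finset.sum_comm]
    calc _ ≤ ∑ w ∈ S.powerset, U := Finset.sum_le_sum fun w hw =>
          (sum_cellLoss_le_risk F hθ hh hs g σ t c hS w).trans (hU w (Finset.mem_powerset.1 hw))
      _ = _ := by
        rw [Finset.sum_const, Finset.card_powerset, nsmul_eq_mul]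
        push_cast
        rfl
  rcases S.eq_empty_or_nonempty with rfl | hne
  · simp
  have hc1 : S.card = (S.card - 1) + 1 := by have := hne.card_pos; omega
  have h2 : (2 : ℝ≥0∞) ^ (S.card - 1) * (S.card * ENNReal.ofReal (D / 2)) ≤
      2 ^ (S.card - 1) * (2 * U) := by
    calc _ = ∑ k ∈ S, 2 ^ (S.card - 1) * ENNReal.ofReal (D / 2) := by
          rw [Finset.sum_const, nsmul_eq_mul]; ring
      _ ≤ _ := Finset.sum_le_sum hk
      _ ≤ _ := hle
      _ = _ := by rw [← mul_assoc, ← pow_succ, ← hc1]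
  have h3 := (ENNReal.mul_le_mul_iff_right (pow_ne_zero _ two_ne_zero)
    (ENNReal.pow_ne_top ENNReal.ofNat_ne_top)).1 h2
  have h4 : (S.card : ℝ≥0∞) * ENNReal.ofReal (D / 2) =
      2 * ENNReal.ofReal (S.card * (c ^ 2 * h * ∫ x, θ x ^ 2) / 8) := by
    rw [← ENNReal.ofReal_natCast, ← ENNReal.ofReal_mul (Nat.cast_nonneg _),
      ← ENNReal.ofReal_ofNat 2, ← ENNReal.ofReal_mul zero_le_two, hDdef]
    congr 1
    ring
  rw [h4] at h3
  exact (ENNReal.mul_le_mul_iff_right two_ne_zero ENNReal.ofNat_ne_top).1 h3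

end

/-! ### Selecting undetectable tiles -/

/-- Lower bound for the minimax risk in terms of the width `h`, the number `M` and the amplitude
`c` of the perturbations. -/
lemma KernelCond.exists_le_minimaxRisk {r ν : ℕ} {g : ℝ → ℝ} (hr : 1 ≤ r)
    (hg : KernelCond r g) (hν : r ≤ ν) (hg₂ : MemSobolev ν 2 g) (m : ℕ) :
    ∃ a K₁ K₂ : ℝ, 0 < a ∧ 0 < K₁ ∧ 0 < K₂ ∧
      ∀ (n : ℕ) (t : Fin n → ℝ) (T σ A h c : ℝ) (M : ℕ), (∀ i, 0 ≤ t i) → 0 < σ → 0 < h → h ≤ 1 →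
        h * M ≤ T → M * (c ^ 2 * h) * h⁻¹ ^ (2 * m) * K₁ ≤ A ^ 2 →
        n * (c ^ 2 * h ^ (2 * r)) * K₂ ≤ M * σ ^ 2 →
        ENNReal.ofReal (a * (M * (c ^ 2 * h))) ≤ minimaxRisk g σ t (Icc 0 T) m A := by
  obtain ⟨ψ, hψ, hψs, x₀, hx₀⟩ := exists_contDiff_iteratedDeriv_ne_zero r
  obtain ⟨K, hK, hKle⟩ := hg.exists_sum_laplaceConv_tile_sq_le hr hν hg₂ hψ hψs
  set θ := iteratedDeriv r ψ with hθdef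
  have hθ : ContDiff ℝ ∞ θ := contDiff_infty_iteratedDeriv hψ r
  have hθs : tsupport θ ⊆ Ioo 0 1 := (tsupport_iteratedDeriv_subset ψ r).trans hψs
  have hθc : HasCompactSupport θ :=
    isCompact_Icc.of_isClosed_subset (isClosed_tsupport _) (hθs.trans Ioo_subset_Icc_self)
  have hI : 0 < ∫ x, θ x ^ 2 := by
    refine (hθ.continuous.pow 2).integral_pos_of_hasCompactSupport_nonneg_nonzero ?_
      (fun x => sq_nonneg _) (x := x₀) (pow_ne_zero 2 hx₀)
    simp_rw [sq]
    exact hθc.mul_right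
  have hL : 0 < Real.log (5 / 4) := Real.log_pos (by norm_num)
  have hK₁ : 0 ≤ ∑ j ∈ Finset.range (m + 1), ∫ x, iteratedDeriv j θ x ^ 2 :=
    Finset.sum_nonneg fun j _ => integral_nonneg fun x => sq_nonneg _
  -- The `16` is Assouad's `8` times the `2` lost by keeping half of the tiles. The third constant
  -- is chosen so that the average of `V` is at most half the testing threshold; the `+ 1` only
  -- secures positivity.
  refine ⟨(∫ x, θ x ^ 2) / 16, (∑ j ∈ Finset.range (m + 1), ∫ x, iteratedDeriv j θ x ^ 2) + 1,
    2 * K / Real.log (5 / 4), by positivity, by positivity, by positivity, ?_⟩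
  intro n t T σ A h c M ht hσ hh h1 hT hA hn
  refine le_iInf fun F => ?_
  set V : ℕ → ℝ := fun k => ∑ i, (c * laplaceConv g (tile θ h k) (t i)) ^ 2 with hV
  set S := (Finset.range M).filter fun k => V k ≤ σ ^ 2 * Real.log (5 / 4) with hSdef
  set S' := (Finset.range M).filter fun k => ¬ V k ≤ σ ^ 2 * Real.log (5 / 4) with hSdef'
  have hsum : ∑ k ∈ Finset.range M, V k ≤ n * (c ^ 2 * h ^ (2 * r)) * K := by
    simp only [hV]
    rw [Finset.sum_comm]
    calc _ ≤ ∑ _i : Fin n, c ^ 2 * (K * h ^ (2 * r)) := by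
          refine Finset.sum_le_sum fun i _ => ?_
          simp_rw [mul_pow]
          rw [← Finset.mul_sum]
          exact mul_le_mul_of_nonneg_left (hKle h hh h1 M _ (ht i)) (sq_nonneg c)
      _ = _ := by
          rw [Finset.sum_const, Finset.card_univ, Fintype.card_fin, nsmul_eq_mul]
          ring
  -- Markov's inequality for the counting measure on the tiles.
  have hbad : S'.card * (σ ^ 2 * Real.log (5 / 4)) ≤ ∑ k ∈ Finset.range M, V k := by
    calc _ = ∑ _k ∈ S', σ ^ 2 * Real.log (5 / 4) := by rw [Finset.sum_const, nsmul_eq_mul]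
      _ ≤ ∑ k ∈ S', V k := Finset.sum_le_sum fun k hk =>
          (not_le.1 (Finset.mem_filter.1 hk).2).le
      _ ≤ _ := Finset.sum_le_sum_of_subset_of_nonneg (Finset.filter_subset _ _)
          fun k _ _ => Finset.sum_nonneg fun i _ => sq_nonneg _
  have hcard : (S.card : ℝ) + S'.card = M := by
    have := Finset.card_filter_add_card_filter_not (s := Finset.range M)
      (fun k => V k ≤ σ ^ 2 * Real.log (5 / 4))
    rw [Finset.card_range] at this
    exact_mod_cast this
  have hhalf : (M : ℝ) / 2 ≤ S.card := by
    have h2 : (S'.card : ℝ) * (σ ^ 2 * Real.log (5 / 4)) ≤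
        M / 2 * (σ ^ 2 * Real.log (5 / 4)) := by
      have : n * (c ^ 2 * h ^ (2 * r)) * K =
          n * (c ^ 2 * h ^ (2 * r)) * (2 * K / Real.log (5 / 4)) * (Real.log (5 / 4) / 2) := by
        field_simp
      have h3 := mul_le_mul_of_nonneg_right hn (by positivity : 0 ≤ Real.log (5 / 4) / 2)
      linarith
    have := le_of_mul_le_mul_right h2 (by positivity)
    linarith
  have hSM : S ⊆ Finset.range M := Finset.filter_subset _ _
  have hres := le_of_risk_tileSum_le F hg₂.1 hθ hh hθs hσ ht (T := T) (c := c) (S := S)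
    (fun k hk => le_trans (mul_le_mul_of_nonneg_left
      (by exact_mod_cast Finset.mem_range.1 (hSM hk)) hh.le) hT)
    (fun k hk => (Finset.mem_filter.1 hk).2)
    (U := ⨆ f ∈ sobolevBall m A, risk g σ t (Icc 0 T) F f) (fun w hw =>
      le_iSup₂_of_le (tileSum θ h c w) (tileSum_mem_sobolevBall hθ hh h1 hθs
        ((Finset.card_le_card (hw.trans hSM)).trans_eq (Finset.card_range M))
        (le_trans (mul_le_mul_of_nonneg_left (by linarith) (by positivity)) hA)) le_rfl)
  refine le_trans (ENNReal.ofReal_le_ofReal ?_) hres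
  have := mul_le_mul_of_nonneg_right hhalf (by positivity : 0 ≤ c ^ 2 * h * ∫ x, θ x ^ 2)
  nlinarith

/-! ### Choice of the parameters and the rate -/

lemma minimaxRisk_mono {n : ℕ} (g : ℝ → ℝ) (σ : ℝ) (t : Fin n → ℝ) {I J : Set ℝ} (hIJ : I ⊆ J)
    (m : ℕ) (A : ℝ) : minimaxRisk g σ t I m A ≤ minimaxRisk g σ t J m A := by
  refine iInf_mono fun F => iSup₂_mono fun f _ => lintegral_mono fun y => ?_
  gcongr

lemma exists_pos_forall_of_eventually {P : ℕ → ℝ → Prop}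
    (hanti : ∀ n C C', C' ≤ C → P n C → P n C') (hev : ∃ C, 0 < C ∧ ∀ᶠ n in atTop, P n C)
    (hP : ∀ n, ∃ C, 0 < C ∧ P n C) : ∃ C, 0 < C ∧ ∀ n, P n C := by
  obtain ⟨C₀, hC₀, hev⟩ := hev
  obtain ⟨N, hN⟩ := eventually_atTop.1 hev
  have hfin : ∀ N : ℕ, ∃ C, 0 < C ∧ ∀ n < N, P n C := by
    intro N
    induction N with
    | zero => exact ⟨1, one_pos, fun n hn => absurd hn (Nat.not_lt_zero n)⟩
    | succ N ih =>
      obtain ⟨C, hC, h⟩ := ih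
      obtain ⟨C', hC', h'⟩ := hP N
      refine ⟨min C C', lt_min hC hC', fun n hn => ?_⟩
      rcases Nat.lt_succ_iff_lt_or_eq.1 hn with hlt | rfl
      · exact hanti n _ _ (min_le_left _ _) (h n hlt)
      · exact hanti n _ _ (min_le_right _ _) h'
  obtain ⟨C, hC, h⟩ := hfin N
  refine ⟨min C₀ C, lt_min hC₀ hC, fun n => ?_⟩
  rcases lt_or_ge n N with hn | hn
  · exact hanti n _ _ (min_le_right _ _) (h n hn)
  · exact hanti n _ _ (min_le_left _ _) (hN n hn)

end LaplaceDeconv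

theorem theorem1 (g : ℝ → ℝ) (r ν m : ℕ) (hr : 1 ≤ r)
    (hg : LaplaceDeconv.KernelCond r g)
    (hν : r ≤ ν) (hg₁ : LaplaceDeconv.MemSobolev r 1 g) (hg₂ : LaplaceDeconv.MemSobolev ν 2 g)
    (hzeros : LaplaceDeconv.LaplaceZerosNegRe g)
    (hm : m + r ≤ ν + 1)
    (T : ℕ → ℝ) (t : (n : ℕ) → Fin n → ℝ) (hT : LaplaceDeconv.DesignCond T t)
    (σ : ℝ) (hσ : 0 < σ) (A : ℝ) (hA : 0 < A) :
    ∃ C : ℝ, 0 < C ∧ ∀ n : ℕ, 1 ≤ n → 0 < T n →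
      ENNReal.ofReal (C * (T n ^ 2 / (n : ℝ)) ^ ((2 * m : ℝ) / (2 * (m + r) + 1))) ≤
          LaplaceDeconv.minimaxRisk g σ (t n) (Icc 0 (T n)) m A ∧
        ENNReal.ofReal (C * (T n ^ 2 / (n : ℝ)) ^ ((2 * m : ℝ) / (2 * (m + r) + 1))) ≤
          LaplaceDeconv.minimaxRisk g σ (t n) (Ici 0) m A := by
  obtain ⟨a, K₁, K₂, ha, hK₁, hK₂, hmain⟩ := hg.exists_le_minimaxRisk hr hν hg₂ m
  have ht : ∀ n i, 0 ≤ t n i := fun n i => (hT.mem_Icc n i).1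
  suffices hsuff : ∃ C : ℝ, 0 < C ∧ ∀ n : ℕ, 1 ≤ n → 0 < T n →
      ENNReal.ofReal (C * (T n ^ 2 / (n : ℝ)) ^ ((2 * m : ℝ) / (2 * (m + r) + 1))) ≤
        LaplaceDeconv.minimaxRisk g σ (t n) (Icc 0 (T n)) m A by
    obtain ⟨C, hC, h⟩ := hsuff
    exact ⟨C, hC, fun n hn hTn => ⟨h n hn hTn, (h n hn hTn).trans
      (LaplaceDeconv.minimaxRisk_mono g σ (t n) Icc_subset_Ici_self m A)⟩⟩
  refine LaplaceDeconv.exists_pos_forall_of_eventually ?_ ?_ ?_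
  · intro n C C' hCC h hn hTn
    exact (ENNReal.ofReal_le_ofReal (mul_le_mul_of_nonneg_right hCC
      (Real.rpow_nonneg (by positivity) _))).trans (h hn hTn)
  -- Shrinking `h` by `κ` makes the detectability constraint hold; since `κ ≤ 1`, the power `κ ^ p`
  -- is at most `κ`.
  · set κ := min 1 (K₁ * σ ^ 2 / (2 * A ^ 2 * K₂)) with hκdef
    have hκ : 0 < κ := lt_min one_pos (by positivity)
    have hκ1 : κ ≤ 1 := min_le_left _ _
    refine ⟨a * A ^ 2 * κ ^ (2 * m) / (2 * K₁), by positivity, ?_⟩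
    filter_upwards [hT.tendsto_atTop.eventually_ge_atTop 1,
      hT.tendsto_zero.eventually_le_const one_pos] with n hT1 hρ1 hn hTn
    have hn0 : (0 : ℝ) < n := by exact_mod_cast hn
    set x := T n ^ 2 / (n : ℝ) with hx
    have hx0 : 0 < x := by positivity
    set p : ℕ := 2 * (m + r) + 1 with hp
    set ρ := x ^ (1 / (p : ℝ)) with hρ
    have hρ0 : 0 < ρ := Real.rpow_pos_of_pos hx0 _
    have hρle : ρ ≤ 1 := Real.rpow_le_one hx0.le hρ1 (by positivity)
    have hρp : ρ ^ p = x := by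
      rw [hρ, one_div, Real.rpow_inv_natCast_pow hx0.le (by omega)]
    have hexp : x ^ ((2 * m : ℝ) / (2 * (m + r) + 1)) = ρ ^ (2 * m) := by
      rw [hρ, ← Real.rpow_natCast, ← Real.rpow_mul hx0.le]
      congr 1
      push_cast [hp]
      ring
    rw [hexp]
    set h := κ * ρ with hh
    have hh0 : 0 < h := by positivity
    have hh1 : h ≤ 1 := mul_le_one₀ hκ1 hρ0.le hρle
    -- As many cells as fit in `[0, T n]`. Because `T n / h ≥ 1`, rounding down loses at most a
    -- factor two.
    set M := ⌊T n / h⌋₊ with hM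
    have hTh : 1 ≤ T n / h := (one_le_div hh0).2 (hh1.trans hT1)
    have hMle : (M : ℝ) ≤ T n / h := Nat.floor_le (by positivity)
    have hMge : T n / h / 2 ≤ M := by
      have h1 := Nat.lt_floor_add_one (T n / h)
      have h2 : (1 : ℝ) ≤ M := by exact_mod_cast (Nat.one_le_floor_iff _).2 hTh
      linarith
    -- The largest amplitude the Sobolev constraint allows when `M` is replaced by its upper bound
    -- `T n / h`.
    set c := Real.sqrt (A ^ 2 * h ^ (2 * m) / (K₁ * T n)) with hc
    have hc2 : c ^ 2 = A ^ 2 * h ^ (2 * m) / (K₁ * T n) := Real.sq_sqrt (by positivity)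
    have hκp : κ ^ p * (2 * A ^ 2 * K₂) ≤ K₁ * σ ^ 2 := by
      have h1 : κ ^ p ≤ κ := pow_le_of_le_one hκ.le hκ1 (by omega)
      have h2 : κ ≤ K₁ * σ ^ 2 / (2 * A ^ 2 * K₂) := min_le_right _ _
      exact (le_div_iff₀ (by positivity)).1 (h1.trans h2)
    refine le_trans (ENNReal.ofReal_le_ofReal ?_) (hmain n (t n) (T n) σ A h c M (ht n) hσ hh0 hh1
      ((le_div_iff₀' hh0).1 hMle) ?_ ?_)
    · calc a * A ^ 2 * κ ^ (2 * m) / (2 * K₁) * ρ ^ (2 * m)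
          = a * (T n / h / 2 * (A ^ 2 * h ^ (2 * m) / (K₁ * T n) * h)) := by
            rw [hh, mul_pow]
            field_simp
        _ ≤ _ := by rw [hc2]; gcongr
    · calc M * (c ^ 2 * h) * h⁻¹ ^ (2 * m) * K₁
          ≤ T n / h * (c ^ 2 * h) * h⁻¹ ^ (2 * m) * K₁ := by gcongr
        _ = A ^ 2 := by
            rw [hc2, inv_pow]
            field_simp
    · calc n * (c ^ 2 * h ^ (2 * r)) * K₂
          = n * (A ^ 2 * K₂) * h ^ p / (K₁ * T n * h) := by
            rw [hc2, hp, show 2 * (m + r) + 1 = 2 * m + 2 * r + 1 by ring, pow_succ]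
            field_simp
            ring
        _ = κ ^ p * (2 * A ^ 2 * K₂) * (T n / (2 * K₁ * h)) := by
            rw [hh, mul_pow, hρp, hx]
            field_simp
        _ ≤ K₁ * σ ^ 2 * (T n / (2 * K₁ * h)) := by gcongr
        _ = T n / h / 2 * σ ^ 2 := by field_simp
        _ ≤ M * σ ^ 2 := by gcongr
  · intro n
    by_cases hcase : 1 ≤ n ∧ 0 < T n
    · obtain ⟨hn, hTn⟩ := hcase
      have hn0 : (0 : ℝ) < n := by exact_mod_cast hn
      -- For a fixed `n` any positive bound suffices: one tile that fits in `[0, T n]`, with squared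
      -- amplitude `d` meeting both constraints.
      set h := min 1 (T n) with hh
      have hh0 : 0 < h := lt_min one_pos hTn
      set d := min (A ^ 2 / (h * h⁻¹ ^ (2 * m) * K₁)) (σ ^ 2 / (n * h ^ (2 * r) * K₂)) with hd
      have hd0 : 0 < d := lt_min (by positivity) (by positivity)
      have hc2 : Real.sqrt d ^ 2 = d := Real.sq_sqrt hd0.le
      have hX : 0 < (T n ^ 2 / (n : ℝ)) ^ ((2 * m : ℝ) / (2 * (m + r) + 1)) :=
        Real.rpow_pos_of_pos (by positivity) _
      refine ⟨a * (d * h) / (T n ^ 2 / (n : ℝ)) ^ ((2 * m : ℝ) / (2 * (m + r) + 1)),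
        by positivity, fun _ _ => ?_⟩
      rw [div_mul_cancel₀ _ hX.ne']
      have key := hmain n (t n) (T n) σ A h (Real.sqrt d) 1 (ht n) hσ hh0 (min_le_left _ _)
      rw [hc2, Nat.cast_one, mul_one, one_mul, one_mul] at key
      refine key (min_le_right _ _) ?_ ?_
      · have := (le_div_iff₀ (by positivity)).1
          (min_le_left (A ^ 2 / (h * h⁻¹ ^ (2 * m) * K₁)) (σ ^ 2 / (n * h ^ (2 * r) * K₂)))
        calc _ = d * (h * h⁻¹ ^ (2 * m) * K₁) := by ring
          _ ≤ _ := this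
      · have := (le_div_iff₀ (by positivity)).1
          (min_le_right (A ^ 2 / (h * h⁻¹ ^ (2 * m) * K₁)) (σ ^ 2 / (n * h ^ (2 * r) * K₂)))
        calc _ = d * (n * h ^ (2 * r) * K₂) := by ring
          _ ≤ _ := this
    · exact ⟨1, one_pos, fun hn hTn => absurd ⟨hn, hTn⟩ hcase⟩
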